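/- Let $d\ge 1$, let $(M_1,g_1)$ and $(M_2,g_2)$ be smooth oriented $d$-dimensional Riemannian manifolds, possibly with boundary, and let $f:M_1\to M_2$ be a $C^2$ local diffeomorphism. Let $\operatorname{Cof} df\in\Omega^1(M_1;f^*TM_2)$ be the cofactor of the differential of $f$, $$\operatorname{Cof} df=(-1)^{d-1}\,\star^{d-1}_{TM_2}\circ\textstyle\bigwedge^{d-1}df\circ\star^{1}_{TM_1},$$ where $\star^k$ is the Hodge dual on $k$-vectors of the oriented inner product spaces $T_xM_i$, and let $\nabla^{f^*TM_2}$ be the pullback to $f^*TM_2$ of the Levi-Civita connection of $M_2$. Let $\delta_{\nabla^{f^*TM_2}}$ be the coderivative, i.e. the adjoint of $\nabla^{f^*TM_2}$ with respect to compactly supported sections: for $\omega\in\Omega^1(M_1;f^*TM_2)$ of class $C^1$, $\delta_{\nabla^{f^*TM_2}}\omega$ is the unique continuous section of $f^*TM_2$ with $\int_{M_1}\langle\sigma,\delta_{\nabla^{f^*TM_2}}\omega\rangle\,d\mathrm{Vol}_1=\int_{M_1}\langle\nabla^{f^*TM_2}\sigma,\omega\rangle\,d\mathrm{Vol}_1$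 for every $C^1$ section $\sigma$ of $f^*TM_2$ with compact support in the interior of $M_1$; equivalently $\delta_{\nabla^{f^*TM_2}}\omega=-\sum_{i=1}^d(\nabla_{e_i}\omega)(e_i)$ for orthonormal bases $(e_i)$ of the tangent spaces of $M_1$, where $\nabla$ is induced by the Levi-Civita connection of $M_1$ and $\nabla^{f^*TM_2}$. Then the Riemannian Piola identity holds on all of $M_1$: $$\delta_{\nabla^{f^*TM_2}}\operatorname{Cof} df=0,$$ both for the adjoint and for the trace expression of the coderivative. Equivalently, for every $C^1$ section $\xi$ of $f^*TM_2$ with compact support in the interior of $M_1$, the function $\langle\operatorname{Cof} df,\nabla^{f^*TM_2}\xi\rangle_{g_1,g_2}$ is integrable and $$\int_{M_1}\langle\operatorname{Cof} df,\nabla^{f^*TM_2}\xi\rangle_{g_1,g_2}\,d\mathrm{Vol}_1=0,$$ where $\langle\cdot,\cdot\rangle_{g_1,g_2}$ is the inner product induced on $T^*M_1\otimes f^*TM_2$. -/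

import Mathlib

open Bundle Manifold MeasureTheory Module
open scoped ContDiff Topology ExteriorAlgebra

noncomputable section

namespace RiemannianPiola

/-! ### Linear algebra: Hodge dual and cofactor -/

section LinearAlgebra

variable {d : ℕ}
  {V : Type*} [NormedAddCommGroup V] [InnerProductSpace ℝ V] [Fact (finrank ℝ V = d)]
  [FiniteDimensional ℝ V]
  {W : Type*} [NormedAddCommGroup W] [InnerProductSpace ℝ W] [Fact (finrank ℝ W = d)]
  [FiniteDimensional ℝ W]

/-- The unit volume form of an oriented `d`-dimensional inner product space, as a linear functional
on the exterior algebra: `v₁ ∧ ⋯ ∧ v_d ↦ Vol(v₁, …, v_d)`, and zero in all degrees other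
than `d`. -/
def volFunctional (o : Orientation ℝ V (Fin d)) : ExteriorAlgebra ℝ V →ₗ[ℝ] ℝ :=
  ExteriorAlgebra.liftAlternating (Pi.single d o.volumeForm)

/-- The Hodge dual `⋆ᵏ : ⋀ᵏ V → ⋀ˡ V` on multivectors, of interest for `k + l = d`. It is
characterized by `γ ∧ ⋆β = ⟨γ, β⟩ Vol`, equivalently by `⟨⋆β, γ⟩ = Vol(β ∧ γ)`. The definition
expands `⋆β` in the orthonormal basis `e_J = e_{j₁} ∧ ⋯ ∧ e_{jₗ}`, `j₁ < ⋯ < jₗ`, of `⋀ˡ V` that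
comes from an orthonormal basis `e` of `V`:  `⋆β = ∑_J Vol(β ∧ e_J) e_J`. -/
def hodgeStar (o : Orientation ℝ V (Fin d)) (k l : ℕ) : (⋀[ℝ]^k V) →ₗ[ℝ] (⋀[ℝ]^l V) :=
  ∑ J : Fin l ↪o Fin (finrank ℝ V),
    (volFunctional o ∘ₗ
      LinearMap.mulRight ℝ (ExteriorAlgebra.ιMulti ℝ l (fun i ↦ stdOrthonormalBasis ℝ V (J i))) ∘ₗ
      (⋀[ℝ]^k V).subtype).smulRight
    (exteriorPower.ιMulti ℝ l (fun i ↦ stdOrthonormalBasis ℝ V (J i)))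

/-- The intrinsic cofactor `Cof A = (-1)^(d-1) ⋆_W^{d-1} ∘ ⋀^{d-1} A ∘ ⋆_V^1` of a linear map
between oriented `d`-dimensional inner product spaces, with `⋀¹ V = V` and `⋀¹ W = W`. -/
def cof (oV : Orientation ℝ V (Fin d)) (oW : Orientation ℝ W (Fin d)) (A : V →ₗ[ℝ] W) :
    V →ₗ[ℝ] W :=
  (-1 : ℝ) ^ (d - 1) •
    ((exteriorPower.oneEquiv (R := ℝ) (M := W)).toLinearMap ∘ₗ hodgeStar oW (d - 1) 1 ∘ₗ
      exteriorPower.map (d - 1) A ∘ₗ hodgeStar oV 1 (d - 1) ∘ₗ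
      (exteriorPower.oneEquiv (R := ℝ) (M := V)).symm.toLinearMap)

/-- The inner product of `V^* ⊗ W = Hom(V, W)`: `⟨A, B⟩ = ∑ᵢ ⟨A eᵢ, B eᵢ⟩` for an orthonormal basis
`e` of `V`. -/
def innerHom (A B : V → W) : ℝ :=
  ∑ i, inner ℝ (A (stdOrthonormalBasis ℝ V i)) (B (stdOrthonormalBasis ℝ V i))

end LinearAlgebra

/-! ### Manifolds -/

section Manifold

variable {d : ℕ} {H : Type*} [TopologicalSpace H]
  {I : ModelWithCorners ℝ (EuclideanSpace ℝ (Fin d)) H}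

instance finiteDimensional_tangentSpace {M : Type*} [TopologicalSpace M] [ChartedSpace H M]
    (x : M) : FiniteDimensional ℝ (TangentSpace I x) :=
  inferInstanceAs (FiniteDimensional ℝ (EuclideanSpace ℝ (Fin d)))

instance fact_finrank_tangentSpace {M : Type*} [TopologicalSpace M] [ChartedSpace H M]
    (x : M) : Fact (finrank ℝ (TangentSpace I x) = d) :=
  ⟨(finrank_euclideanSpace_fin : finrank ℝ (EuclideanSpace ℝ (Fin d)) = d)⟩

variable (I) in
/-- An orientation of a `d`-dimensional manifold: an orientation of every tangent space that is
locally constant in the coordinates given by charts. -/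
structure ManifoldOrientation (M : Type*) [TopologicalSpace M] [ChartedSpace H M]
    [IsManifold I ∞ M] where
  /-- the orientation of the tangent space at a point -/
  at' : ∀ x : M, Orientation ℝ (TangentSpace I x) (Fin d)
  locallyConstant : ∀ x₀ : M, ∀ᶠ x in 𝓝 x₀,
    ∀ hx : x ∈ (trivializationAt (EuclideanSpace ℝ (Fin d)) (TangentSpace I) x₀).baseSet,
      Orientation.map (Fin d)
          ((trivializationAt (EuclideanSpace ℝ (Fin d)) (TangentSpace I) x₀).linearEquivAt ℝ x hx)
          (at' x) =
        Orientation.map (Fin d)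
          ((trivializationAt (EuclideanSpace ℝ (Fin d)) (TangentSpace I) x₀).linearEquivAt ℝ x₀
            (mem_baseSet_trivializationAt (EuclideanSpace ℝ (Fin d)) (TangentSpace I) x₀))
          (at' x₀)

variable {M : Type*} [TopologicalSpace M] [ChartedSpace H M] [IsManifold I ∞ M]

variable (I) in
/-- The coordinate vector field `∑ uⁱ ∂ᵢ` of the preferred chart at `q`, with constant
coefficients `u` (used only at points `x` of the domain of that chart). -/
def coordField (q : M) (u : EuclideanSpace ℝ (Fin d)) (x : M) : TangentSpace I x :=
  (trivializationAt (EuclideanSpace ℝ (Fin d)) (TangentSpace I) q).symmL ℝ x u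

variable [RiemannianBundle (fun x : M ↦ TangentSpace I x)]

variable (I) in
/-- `∂_w ⟨X_u, X_v⟩` at `q`, for the coordinate vector fields `X_u`, `X_v` of the chart at `q`. -/
def metricDeriv (q : M) (w u v : TangentSpace I q) : ℝ :=
  mfderiv I 𝓘(ℝ, ℝ) (fun x : M ↦ inner ℝ (coordField I q u x) (coordField I q v x)) q w

variable (I) in
/-- The Christoffel symbol `Γ(u, v)` of the Levi-Civita connection at `q`, in the preferred chart
at `q`:  `⟨Γ(u, v), w⟩ = ½ (∂_u ⟨X_v, X_w⟩ + ∂_v ⟨X_u, X_w⟩ - ∂_w ⟨X_u, X_v⟩)`,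
with the index raised by means of an orthonormal basis of the tangent space. -/
def christoffel (q : M) (u v : TangentSpace I q) : TangentSpace I q :=
  ∑ i, ((1 / 2 : ℝ) *
      (metricDeriv I q u v (stdOrthonormalBasis ℝ (TangentSpace I q) i)
        + metricDeriv I q v u (stdOrthonormalBasis ℝ (TangentSpace I q) i)
        - metricDeriv I q (stdOrthonormalBasis ℝ (TangentSpace I q) i) u v)) •
    stdOrthonormalBasis ℝ (TangentSpace I q) i

variable (I) in
/-- The matrix `⟨∂ᵢ, ∂ⱼ⟩` of the metric in the preferred chart at `q`, as a function on the image of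
that chart. -/
def gramMatrix (q : M) (y : EuclideanSpace ℝ (Fin d)) : Matrix (Fin d) (Fin d) ℝ :=
  Matrix.of fun i j ↦
    inner ℝ (coordField I q (EuclideanSpace.single i 1) ((extChartAt I q).symm y))
      (coordField I q (EuclideanSpace.single j 1) ((extChartAt I q).symm y))

variable (I) in
/-- The Riemannian volume measure of the domain of the preferred chart at `q`: the image under the
inverse chart of `√(det g) dy`. -/
def chartVolume [MeasurableSpace M] (q : M) : Measure M :=
  Measure.map (extChartAt I q).symm
    (((volume : Measure (EuclideanSpace ℝ (Fin d))).restrict (extChartAt I q).target).withDensity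
      fun y ↦ ENNReal.ofReal (Real.sqrt (gramMatrix I q y).det))

variable (I M) in
/-- The Riemannian volume measure `dVol`: the measure whose restriction to the domain of every
chart is the chart's `√(det g) dy`. As these local measures agree on overlaps, it is their
supremum. -/
def riemannianVolume [MeasurableSpace M] : Measure M := ⨆ q : M, chartVolume I q

end Manifold

/-! ### Sections along a map and the pullback connection -/

section Along

variable {d : ℕ} {H : Type*} [TopologicalSpace H]
  {I : ModelWithCorners ℝ (EuclideanSpace ℝ (Fin d)) H}
  {M₁ : Type*} [TopologicalSpace M₁] [ChartedSpace H M₁] [IsManifold I ∞ M₁]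
  [RiemannianBundle (fun x : M₁ ↦ TangentSpace I x)]
  {M₂ : Type*} [TopologicalSpace M₂] [ChartedSpace H M₂] [IsManifold I ∞ M₂]
  [RiemannianBundle (fun x : M₂ ↦ TangentSpace I x)]

variable (I) in
/-- The covariant derivative `∇_v^{f^*TM₂} ξ` at `p` of a section `ξ` of `f^*TM₂`, for the pullback
of the Levi-Civita connection of `M₂`: in the chart of `M₂` at `f p` it is
`∂_v ξ^β + Γ^β_{γδ} (df v)^γ ξ^δ`. -/
def covDerivAlong (f : M₁ → M₂) (ξ : ∀ x, TangentSpace I (f x)) (p : M₁)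
    (v : TangentSpace I p) : TangentSpace I (f p) :=
  (trivializationAt (EuclideanSpace ℝ (Fin d)) (TangentSpace I) (f p)).symmL ℝ (f p)
      (mfderiv I 𝓘(ℝ, EuclideanSpace ℝ (Fin d))
        (fun x ↦ (trivializationAt (EuclideanSpace ℝ (Fin d)) (TangentSpace I)
          (f p)).continuousLinearMapAt ℝ (f x) (ξ x)) p v)
    + christoffel I (f p) (mfderiv I I f p v) (ξ p)

variable (I) in
/-- The covariant derivative `(∇_v α)(u)` at `p` of `α ∈ Ω¹(M₁; f^*TM₂)`, for the connection induced
by the Levi-Civita connection of `M₁` and the pullback connection: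
`(∇_v α)(U) = ∇_v (α(U)) - α(∇_v U)`, where `U` is the coordinate field with `U(p) = u` and the
Levi-Civita connection of `M₁` is the pullback connection along the identity. -/
def covDerivForm (f : M₁ → M₂) (α : ∀ x, TangentSpace I x →ₗ[ℝ] TangentSpace I (f x))
    (p : M₁) (v u : TangentSpace I p) : TangentSpace I (f p) :=
  covDerivAlong I f (fun x ↦ α x (coordField I p u x)) p v
    - α p (covDerivAlong I (fun x : M₁ ↦ x) (coordField I p u) p v)

variable (I) in
/-- The coderivative `δα = -tr_g (∇α) = -∑ᵢ (∇_{eᵢ} α)(eᵢ)` of `α ∈ Ω¹(M₁; f^*TM₂)`, for an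
orthonormal basis `e` of the tangent space. -/
def coderivative (f : M₁ → M₂) (α : ∀ x, TangentSpace I x →ₗ[ℝ] TangentSpace I (f x))
    (p : M₁) : TangentSpace I (f p) :=
  -∑ i, covDerivForm I f α p (stdOrthonormalBasis ℝ (TangentSpace I p) i)
      (stdOrthonormalBasis ℝ (TangentSpace I p) i)

variable (I) in
/-- `ξ` is a `C^1` section of `f^*TM₂`, compactly supported in the interior of `M₁`. -/
structure IsTestSection (f : M₁ → M₂) (ξ : ∀ x, TangentSpace I (f x)) : Prop where
  contMDiff : ContMDiff I I.tangent 1 (fun x ↦ (⟨f x, ξ x⟩ : TangentBundle I M₂))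
  compactSupport : ∃ K : Set M₁, IsCompact K ∧ K ⊆ I.interior M₁ ∧ ∀ x ∉ K, ξ x = 0

variable (I) in
/-- The section `η` of `f^*TM₂` is the coderivative of `α` in the sense that it represents the
adjoint of the pullback connection: `∫ ⟨σ, η⟩ dVol = ∫ ⟨∇σ, α⟩ dVol` for all test sections `σ`. -/
def IsAdjointCoderivative [MeasurableSpace M₁] (f : M₁ → M₂)
    (α : ∀ x, TangentSpace I x →ₗ[ℝ] TangentSpace I (f x)) (η : ∀ x, TangentSpace I (f x)) :
    Prop :=
  ∀ σ : ∀ x, TangentSpace I (f x), IsTestSection I f σ →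
    ∫ x, inner ℝ (σ x) (η x) ∂(riemannianVolume I M₁) =
      ∫ x, innerHom (covDerivAlong I f σ x) (α x) ∂(riemannianVolume I M₁)

/-- The cofactor `Cof df ∈ Ω¹(M₁; f^*TM₂)` of the differential of `f`. -/
def cofDifferential (o₁ : ManifoldOrientation I M₁) (o₂ : ManifoldOrientation I M₂) (f : M₁ → M₂)
    (x : M₁) : TangentSpace I x →ₗ[ℝ] TangentSpace I (f x) :=
  cof (o₁.at' x) (o₂.at' (f x)) (mfderiv I I f x : TangentSpace I x →ₗ[ℝ] TangentSpace I (f x))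

end Along

end RiemannianPiola

end

/-!
The cofactor satisfies `⟨Cof df v, ξ⟩ = ⟨v, X⟩` for the vector field `X = det(df) df⁻¹ ξ` on `M₁`,
where `det(df)` is taken with respect to the two volume forms. In charts, `√g₁ X` is (up to sign)
the Euclidean Piola transform `det(DF) DF⁻¹ (√g₂ ξ)` of the coordinate expression `F` of `f`.
In its divergence the second derivatives of `F` cancel by symmetry, and the derivative of `√g₂`
supplies the Christoffel symbols of `M₂`, so `div X = ⟨Cof df, ∇ξ⟩`. For any one-form `α` along
`f` with dual field `X`, metric compatibility gives `⟨δα, ξ⟩ = ⟨α, ∇ξ⟩ - div X`; hence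
`δ(Cof df) = 0` pointwise, and the weak form is the divergence theorem for `X`. A continuous
section representing the adjoint is orthogonal to all test sections, which forces it to vanish.
-/

noncomputable section

namespace RiemannianPiola

/-! ### Exterior powers and the cofactor -/

section Cofactor

variable {d : ℕ}
  {V : Type*} [NormedAddCommGroup V] [InnerProductSpace ℝ V]
  {W : Type*} [NormedAddCommGroup W] [InnerProductSpace ℝ W]

lemma volFunctional_ιMulti [Fact (finrank ℝ V = d)] (o : Orientation ℝ V (Fin d))
    (v : Fin d → V) : volFunctional o (ExteriorAlgebra.ιMulti ℝ d v) = o.volumeForm v := by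
  simp [volFunctional]

lemma volFunctional_map [Fact (finrank ℝ V = d)] [Fact (finrank ℝ W = d)]
    {oV : Orientation ℝ V (Fin d)} {oW : Orientation ℝ W (Fin d)} {A : V →ₗ[ℝ] W} {c : ℝ}
    (h : oW.volumeForm.compLinearMap A = c • oV.volumeForm) (x : ExteriorAlgebra ℝ V) :
    volFunctional oW (ExteriorAlgebra.map A x) = c * volFunctional oV x := by
  suffices volFunctional oW ∘ₗ (ExteriorAlgebra.map A).toLinearMap = c • volFunctional oV by
    simpa using DFunLike.congr_fun this x
  refine ExteriorAlgebra.lhom_ext fun i ↦ ?_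
  ext v
  obtain rfl | hi := eq_or_ne i d
  · simpa [volFunctional, ExteriorAlgebra.map_apply_ιMulti, Function.comp_def]
      using DFunLike.congr_fun h v
  · simp [volFunctional, ExteriorAlgebra.map_apply_ιMulti, Pi.single_eq_of_ne hi]

section Algebra

variable {R N N' : Type*} [CommRing R] [AddCommGroup N] [Module R N] [AddCommGroup N'] [Module R N']

lemma coe_exteriorPower_map (k : ℕ) (A : N →ₗ[R] N') (x : ⋀[R]^k N) :
    (exteriorPower.map k A x : ExteriorAlgebra R N') = ExteriorAlgebra.map A x := by
  have : (⋀[R]^k N').subtype ∘ₗ exteriorPower.map k A =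
      (ExteriorAlgebra.map A).toLinearMap ∘ₗ (⋀[R]^k N).subtype := by
    ext v
    simp [ExteriorAlgebra.map_apply_ιMulti, exteriorPower.map_apply_ιMulti]
  exact DFunLike.congr_fun this x

lemma ιMulti_one (v : Fin 1 → N) : ExteriorAlgebra.ιMulti R 1 v = ExteriorAlgebra.ι R (v 0) := by
  simp [ExteriorAlgebra.ιMulti_apply]

lemma ιMulti_mul_ι (k : ℕ) (u : Fin k → N) (w : N) :
    ExteriorAlgebra.ιMulti R k u * ExteriorAlgebra.ι R w =
      (-1 : R) ^ k • (ExteriorAlgebra.ι R w * ExteriorAlgebra.ιMulti R k u) := by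
  induction k with
  | zero => simp
  | succ k ih =>
    rw [ExteriorAlgebra.ιMulti_succ_apply, mul_assoc, ih, mul_smul_comm, ← mul_assoc, ← mul_assoc,
      eq_neg_of_add_eq_zero_left (ExteriorAlgebra.ι_add_mul_swap (R := R) (u 0) w), pow_succ]
    simp

end Algebra

lemma succAboveOrderEmb_bijective (n : ℕ) :
    Function.Bijective (Fin.succAboveOrderEmb : Fin (n + 1) → Fin n ↪o Fin (n + 1)) := by
  refine ⟨fun i j h ↦ Fin.succAbove_left_injective (congrArg (⇑) h), fun J ↦ ?_⟩
  obtain ⟨j, hj⟩ : ∃ j, j ∉ Set.range J := by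
    by_contra! h
    simpa using Fintype.card_le_of_surjective J h
  have hsub : Set.range J ⊆ Set.range (Fin.succAboveOrderEmb j) := by
    rw [Fin.range_succAboveOrderEmb]
    rintro _ hi rfl
    exact hj hi
  refine ⟨j, OrderEmbedding.range_inj.1 (Set.eq_of_subset_of_ncard_le hsub ?_).symm⟩
  rw [Set.ncard_range_of_injective J.injective,
    Set.ncard_range_of_injective (Fin.succAboveOrderEmb j).injective]

lemma oneEquiv_hodgeStar [Fact (finrank ℝ V = d)] [FiniteDimensional ℝ V]
    (o : Orientation ℝ V (Fin d)) (k : ℕ) (β : ⋀[ℝ]^k V) :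
    exteriorPower.oneEquiv ℝ V (hodgeStar o k 1 β) =
      ∑ j, volFunctional o (β * ExteriorAlgebra.ι ℝ (stdOrthonormalBasis ℝ V j)) •
        stdOrthonormalBasis ℝ V j := by
  let singleton : (Fin 1 ↪o Fin (finrank ℝ V)) ≃ Fin (finrank ℝ V) :=
    { toFun := fun J ↦ J 0
      invFun := fun j ↦ OrderEmbedding.ofStrictMono (fun _ ↦ j) (Subsingleton.strictMono _)
      left_inv := fun J ↦ by ext i; simp [Subsingleton.elim i 0]
      right_inv := fun j ↦ by simp }
  rw [← singleton.sum_comp]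
  simp only [hodgeStar, LinearMap.sum_apply, map_sum, LinearMap.smulRight_apply, map_smul,
    exteriorPower.oneEquiv_ιMulti, ιMulti_one]
  rfl

lemma inner_oneEquiv_hodgeStar [Fact (finrank ℝ V = d)] [FiniteDimensional ℝ V]
    (o : Orientation ℝ V (Fin d)) (k : ℕ) (β : ⋀[ℝ]^k V) (w : V) :
    inner ℝ (exteriorPower.oneEquiv ℝ V (hodgeStar o k 1 β)) w =
      volFunctional o (β * ExteriorAlgebra.ι ℝ w) := by
  rw [oneEquiv_hodgeStar, sum_inner]
  conv_rhs => rw [← (stdOrthonormalBasis ℝ V).sum_repr' w]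
  simp only [map_sum, map_smul, Finset.mul_sum, mul_smul_comm, inner_smul_left, smul_eq_mul,
    conj_trivial, mul_comm]

section OrthonormalBasis

variable {n : ℕ} [Fact (finrank ℝ V = n + 1)] (o : Orientation ℝ V (Fin (n + 1)))
  (e : OrthonormalBasis (Fin (n + 1)) ℝ V)

lemma volumeForm_cons_succAbove_sq (j : Fin (n + 1)) :
    o.volumeForm (Fin.cons (e j) fun i ↦ e (j.succAbove i)) ^ 2 = 1 := by
  have hinj : Function.Injective (Fin.cons j fun i ↦ j.succAbove i : Fin (n + 1) → Fin (n + 1)) :=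
    Fin.cons_injective_iff.2 ⟨by simp, Fin.succAbove_right_injective⟩
  let σ := Equiv.ofBijective _ (Finite.injective_iff_bijective.1 hinj)
  have hcons : ⇑(e.reindex σ.symm) = Fin.cons (e j) fun i ↦ e (j.succAbove i) := by
    funext i
    refine Fin.cases ?_ (fun i ↦ ?_) i <;> simp [σ]
  rw [← hcons, ← sq_abs, o.abs_volumeForm_apply_of_orthonormal, one_pow]

lemma volFunctional_ι_mul_ιMulti_succAbove (v : V) (j : Fin (n + 1)) :
    volFunctional o (ExteriorAlgebra.ι ℝ v *
        ExteriorAlgebra.ιMulti ℝ n fun i ↦ e (j.succAbove i)) =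
      inner ℝ (e j) v * o.volumeForm (Fin.cons (e j) fun i ↦ e (j.succAbove i)) := by
  have hcons (u : V) : volFunctional o (ExteriorAlgebra.ι ℝ u *
      ExteriorAlgebra.ιMulti ℝ n fun i ↦ e (j.succAbove i)) =
      o.volumeForm (Fin.cons u fun i ↦ e (j.succAbove i)) := by
    rw [← volFunctional_ιMulti, ExteriorAlgebra.ιMulti_succ_apply]
    rfl
  have hrepeat (i : Fin (n + 1)) (hi : i ≠ j) :
      o.volumeForm (Fin.cons (e i) fun i ↦ e (j.succAbove i)) = 0 := by
    obtain ⟨k, rfl⟩ := Fin.exists_succAbove_eq hi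
    exact o.volumeForm.map_eq_zero_of_eq _ (i := 0) (j := k.succ) (by simp)
      (Fin.succ_ne_zero k).symm
  conv_lhs => rw [← e.sum_repr' v]
  simp only [map_sum, map_smul, Finset.sum_mul, smul_mul_assoc, smul_eq_mul, hcons]
  exact Finset.sum_eq_single j (fun i _ hi ↦ by rw [hrepeat i hi, mul_zero]) (by simp)

lemma sum_volFunctional_mul_volFunctional {m : ℕ} (e : OrthonormalBasis (Fin m) ℝ V) (v w : V) :
    ∑ J : Fin n ↪o Fin m,
      volFunctional o (ExteriorAlgebra.ι ℝ v * ExteriorAlgebra.ιMulti ℝ n fun i ↦ e (J i)) *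
      volFunctional o (ExteriorAlgebra.ι ℝ w * ExteriorAlgebra.ιMulti ℝ n fun i ↦ e (J i)) =
      inner ℝ v w := by
  obtain rfl : m = n + 1 := by
    simpa [Fact.out (p := finrank ℝ V = n + 1)] using (finrank_eq_card_basis e.toBasis).symm
  rw [← (succAboveOrderEmb_bijective n).sum_comp, ← e.sum_inner_mul_inner v w]
  refine Finset.sum_congr rfl fun j _ ↦ ?_
  simp only [Fin.succAboveOrderEmb_apply, volFunctional_ι_mul_ιMulti_succAbove]
  rw [real_inner_comm (e j) v]
  linear_combination
    inner ℝ (e j) v * inner ℝ (e j) w * volumeForm_cons_succAbove_sq o e j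

end OrthonormalBasis

lemma volFunctional_hodgeStar_mul_ι [NeZero d] [Fact (finrank ℝ V = d)] [FiniteDimensional ℝ V]
    (o : Orientation ℝ V (Fin d)) (v w : V) :
    volFunctional o ((hodgeStar o 1 (d - 1) ((exteriorPower.oneEquiv ℝ V).symm v) :
      ExteriorAlgebra ℝ V) * ExteriorAlgebra.ι ℝ w) = (-1) ^ (d - 1) * inner ℝ v w := by
  obtain ⟨n, rfl⟩ := Nat.exists_eq_succ_of_ne_zero (NeZero.ne d)
  have hv : (exteriorPower.oneEquiv ℝ V).symm v = exteriorPower.ιMulti ℝ 1 fun _ ↦ v := by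
    rw [LinearEquiv.symm_apply_eq, exteriorPower.oneEquiv_ιMulti]
  rw [← sum_volFunctional_mul_volFunctional o (stdOrthonormalBasis ℝ V) v w, Finset.mul_sum]
  simp only [hodgeStar, hv, LinearMap.sum_apply, LinearMap.smulRight_apply,
    AddSubmonoidClass.coe_finsetSum, Finset.sum_mul, map_sum]
  refine Finset.sum_congr rfl fun J _ ↦ ?_
  simp [ιMulti_mul_ι, mul_left_comm]

theorem inner_cof_apply [NeZero d] [Fact (finrank ℝ V = d)] [FiniteDimensional ℝ V]
    [Fact (finrank ℝ W = d)] [FiniteDimensional ℝ W]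
    {oV : Orientation ℝ V (Fin d)} {oW : Orientation ℝ W (Fin d)} {A : V →ₗ[ℝ] W} {c : ℝ}
    (h : oW.volumeForm.compLinearMap A = c • oV.volumeForm) (v w : V) :
    inner ℝ (cof oV oW A v) (A w) = c * inner ℝ v w := by
  simp only [cof, LinearMap.smul_apply, LinearMap.comp_apply, LinearEquiv.coe_coe,
    inner_smul_left, conj_trivial]
  rw [inner_oneEquiv_hodgeStar, coe_exteriorPower_map, ← ExteriorAlgebra.map_apply_ι, ← map_mul,
    volFunctional_map h, volFunctional_hodgeStar_mul_ι]
  have hsign : (-1 : ℝ) ^ (d - 1) * (-1) ^ (d - 1) = 1 := by rw [← mul_pow]; simp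
  linear_combination c * inner ℝ v w * hsign

lemma innerHom_eq_trace [FiniteDimensional ℝ V] [FiniteDimensional ℝ W] (A B : V →ₗ[ℝ] W) :
    innerHom A B = LinearMap.trace ℝ V (LinearMap.adjoint A ∘ₗ B) := by
  simp only [LinearMap.trace_eq_sum_inner _ (stdOrthonormalBasis ℝ V), innerHom,
    LinearMap.comp_apply, LinearMap.adjoint_inner_right]

lemma innerHom_comm [FiniteDimensional ℝ V] (A B : V → W) : innerHom A B = innerHom B A :=
  Finset.sum_congr rfl fun _ _ ↦ real_inner_comm _ _

end Cofactor

/-! ### Determinants and the Euclidean Piola identity -/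

section Calculus

variable {E : Type*} [NormedAddCommGroup E] [NormedSpace ℝ E]

lemma det_clm_comp (A B : E →L[ℝ] E) : (A ∘L B).det = A.det * B.det :=
  LinearMap.det_comp _ _

/-- The endomorphism `∑ᵢ B(bᵢ, ·) bᵢ`. For `b` an orthonormal basis with respect to some inner
product, it represents the symmetric bilinear form `B` through that inner product. -/
def raiseIndex {ι : Type*} [Fintype ι] (b : ι → E) : (E →L[ℝ] E →L[ℝ] ℝ) →L[ℝ] E →L[ℝ] E :=
  ∑ i, (ContinuousLinearMap.smulRightL ℝ E E).flip (b i) ∘L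
    ContinuousLinearMap.apply ℝ (E →L[ℝ] ℝ) (b i)

lemma raiseIndex_apply {ι : Type*} [Fintype ι] (b : ι → E) (B : E →L[ℝ] E →L[ℝ] ℝ) (u : E) :
    raiseIndex b B u = ∑ i, B (b i) u • b i := by
  simp [raiseIndex]

variable [FiniteDimensional ℝ E]

lemma contDiff_det {n : WithTop ℕ∞} :
    ContDiff ℝ n (ContinuousLinearMap.det : (E →L[ℝ] E) → ℝ) := by
  let b := Module.finBasis ℝ E
  have hentry (i j : Fin (finrank ℝ E)) :
      ContDiff ℝ n fun A : E →L[ℝ] E ↦ LinearMap.toMatrix b b A i j := by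
    simp only [LinearMap.toMatrix_apply]
    exact ((LinearMap.toContinuousLinearMap (b.coord i)) ∘L
      ContinuousLinearMap.apply ℝ E (b j)).contDiff
  have hdet : (ContinuousLinearMap.det : (E →L[ℝ] E) → ℝ) =
      fun A : E →L[ℝ] E ↦ (LinearMap.toMatrix b b (A : E →ₗ[ℝ] E)).det := by
    funext A
    rw [LinearMap.det_toMatrix, ContinuousLinearMap.det]
  simp only [hdet, Matrix.det_apply]
  exact ContDiff.sum fun σ _ ↦ (contDiff_prod fun i _ ↦ hentry _ i).const_smul _

variable (E) in
/-- The trace of endomorphisms of a finite-dimensional normed space, as a continuous functional. -/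
def traceCLM : (E →L[ℝ] E) →L[ℝ] ℝ :=
  LinearMap.toContinuousLinearMap (LinearMap.trace ℝ E ∘ₗ ContinuousLinearMap.coeLM ℝ)

@[simp]
lemma traceCLM_apply (A : E →L[ℝ] E) : traceCLM E A = LinearMap.trace ℝ E A := rfl

lemma trace_raiseIndex {ι : Type*} [Fintype ι] (b : ι → E) (B : E →L[ℝ] E →L[ℝ] ℝ) :
    traceCLM E (raiseIndex b B) = ∑ i, B (b i) (b i) := by
  simp only [raiseIndex, FunLike.coe_sum, Finset.sum_apply, map_sum]
  exact Finset.sum_congr rfl fun i _ ↦ LinearMap.trace_smulRight _ _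

lemma hasDerivAt_det_id_add_smul (A : E →L[ℝ] E) :
    HasDerivAt (fun t : ℝ ↦ (ContinuousLinearMap.id ℝ E + t • A).det)
      (LinearMap.trace ℝ E A) 0 := by
  let b := Module.finBasis ℝ E
  let M := LinearMap.toMatrix b b (A : E →ₗ[ℝ] E)
  let P : Polynomial ℝ := (1 + (Polynomial.X : Polynomial ℝ) • M.map Polynomial.C).det
  have hP (t : ℝ) : (ContinuousLinearMap.id ℝ E + t • A).det = P.eval t := by
    rw [ContinuousLinearMap.det, ← LinearMap.det_toMatrix b, ← Polynomial.coe_evalRingHom,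
      RingHom.map_det]
    congr 1
    ext i j
    simp [M, Matrix.one_apply, LinearMap.toMatrix_apply, Finsupp.single_apply, eq_comm, apply_ite]
    ring
  simp only [hP, LinearMap.trace_eq_matrix_trace ℝ b, ← Matrix.derivative_det_one_add_X_smul]
  exact P.hasDerivAt 0

lemma hasFDerivAt_det_id :
    HasFDerivAt ContinuousLinearMap.det (traceCLM E) (ContinuousLinearMap.id ℝ E) := by
  have hdiff : DifferentiableAt ℝ ContinuousLinearMap.det (ContinuousLinearMap.id ℝ E) :=
    (contDiff_det (n := 1)).differentiable one_ne_zero _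
  refine hdiff.hasFDerivAt.congr_fderiv ?_
  ext A
  refine HasDerivAt.unique ?_ (hasDerivAt_det_id_add_smul A)
  have hline : HasDerivAt (fun t : ℝ ↦ ContinuousLinearMap.id ℝ E + t • A) A 0 := by
    simpa using ((hasDerivAt_id (0 : ℝ)).smul_const A).const_add (ContinuousLinearMap.id ℝ E)
  exact HasFDerivAt.comp_hasDerivAt_of_eq (0 : ℝ) hdiff.hasFDerivAt hline (by simp)

lemma hasFDerivAt_sqrt_det_id :
    HasFDerivAt (fun A : E →L[ℝ] E ↦ √A.det) ((1 / 2 : ℝ) • traceCLM E) (.id ℝ E) := by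
  have hid : (ContinuousLinearMap.id ℝ E).det = 1 := LinearMap.det_id
  have h := hasFDerivAt_det_id (E := E) |>.sqrt (by simp [hid])
  simpa [hid] using h

lemma hasFDerivAt_det (A : E ≃L[ℝ] E) :
    HasFDerivAt ContinuousLinearMap.det
      ((A : E →L[ℝ] E).det • traceCLM E ∘L ContinuousLinearMap.compL ℝ E E E A.symm)
      (A : E →L[ℝ] E) := by
  have hmul (B : E →L[ℝ] E) :
      B.det = (A : E →L[ℝ] E).det * ((A.symm : E →L[ℝ] E) ∘L B).det := by
    rw [det_clm_comp, ← mul_assoc, ← det_clm_comp, A.coe_comp_coe_symm]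
    simp [ContinuousLinearMap.det]
  have hA : (A.symm : E →L[ℝ] E) ∘L A = .id ℝ E := A.coe_symm_comp_coe
  have h := (hA ▸ hasFDerivAt_det_id (E := E)).comp (A : E →L[ℝ] E)
    (ContinuousLinearMap.compL ℝ E E E A.symm).hasFDerivAt
  refine ((h.const_smul (A : E →L[ℝ] E).det).congr_of_eventuallyEq
    (Filter.Eventually.of_forall hmul))

lemma hasFDerivAt_inverse (A : E ≃L[ℝ] E) :
    HasFDerivAt (ContinuousLinearMap.inverse : (E →L[ℝ] E) → E →L[ℝ] E)
      (-(ContinuousLinearMap.compL ℝ E E E A.symm ∘L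
        (ContinuousLinearMap.compL ℝ E E E).flip A.symm)) A := by
  rw [← ContinuousLinearMap.ringInverse_eq_inverse]
  refine (hasFDerivAt_ringInverse (𝕜 := ℝ) (ContinuousLinearEquiv.toUnit A)).congr_fderiv ?_
  ext T w
  rfl

/-- The terms of second order in `F` are `tr (A⁻¹ d²F(A⁻¹ v, ·))` from the determinant and
`-tr (A⁻¹ d²F(·, A⁻¹ v))` from the inverse; they cancel by symmetry of `d²F`. -/
theorem hasFDerivWithinAt_det_smul_inverse {F v : E → E} {v' : E →L[ℝ] E} {S : Set E} {x₀ : E}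
    (hS : UniqueDiffOn ℝ S) (hx₀ : x₀ ∈ S) (hx₀' : x₀ ∈ closure (interior S))
    (hF : ContDiffWithinAt ℝ 2 F S x₀) {A : E ≃L[ℝ] E} (hA : fderivWithin ℝ F S x₀ = A)
    (hv : HasFDerivWithinAt v v' S x₀) :
    ∃ V' : E →L[ℝ] E, HasFDerivWithinAt (fun x ↦ (fderivWithin ℝ F S x).det •
        (fderivWithin ℝ F S x).inverse (v x)) V' S x₀ ∧
      LinearMap.trace ℝ E V' =
        (A : E →L[ℝ] E).det * LinearMap.trace ℝ E ((A.symm : E →L[ℝ] E) ∘L v' : E →L[ℝ] E) := by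
  set A' := fderivWithin ℝ (fderivWithin ℝ F S) S x₀
  have hdiff : DifferentiableWithinAt ℝ (fderivWithin ℝ F S) S x₀ :=
    (hF.fderivWithin_right hS (m := 1) (by norm_num) hx₀).differentiableWithinAt one_ne_zero
  have hA' : HasFDerivWithinAt (fderivWithin ℝ F S) A' S x₀ := hdiff.hasFDerivWithinAt
  have hsymm (w : E) : A' w (A.symm (v x₀)) = A' (A.symm (v x₀)) w :=
    (hF.isSymmSndFDerivWithinAt (by simp) hS hx₀' hx₀).eq _ _
  have hdet := (hA ▸ hasFDerivAt_det A).comp_hasFDerivWithinAt x₀ hA'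
  have hinv := (hA ▸ hasFDerivAt_inverse A).comp_hasFDerivWithinAt x₀ hA'
  let φ : E →L[ℝ] ℝ := traceCLM E ∘L ContinuousLinearMap.compL ℝ E E E A.symm ∘L A'
  refine ⟨(A : E →L[ℝ] E).det • ((A.symm : E →L[ℝ] E) ∘L v' - A.symm ∘L A' (A.symm (v x₀)) +
      φ.smulRight (A.symm (v x₀))),
    (hdet.smul (hinv.clm_apply hv)).congr_fderiv ?_, ?_⟩
  · ext w
    simp [hA, hsymm, φ]
    module
  · have hrank_one : LinearMap.trace ℝ E (φ.smulRight (A.symm (v x₀)) : E →L[ℝ] E) =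
        LinearMap.trace ℝ E ((A.symm : E →L[ℝ] E) ∘L A' (A.symm (v x₀)) : E →L[ℝ] E) :=
      LinearMap.trace_smulRight φ.toLinearMap _
    simp only [ContinuousLinearMap.toLinearMap_smul, ContinuousLinearMap.toLinearMap_add,
      ContinuousLinearMap.toLinearMap_sub, map_smul, map_add, map_sub, hrank_one, smul_eq_mul,
      sub_add_cancel]

end Calculus

variable {d : ℕ} {H : Type*} [TopologicalSpace H]
  {I : ModelWithCorners ℝ (EuclideanSpace ℝ (Fin d)) H}

local notation "𝔼" => EuclideanSpace ℝ (Fin d)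

local instance : NormedAddCommGroup (𝔼 →L[ℝ] 𝔼 →L[ℝ] ℝ) := inferInstance

local instance : NormedSpace ℝ (𝔼 →L[ℝ] 𝔼 →L[ℝ] ℝ) := inferInstance

/-! ### Coordinates of tangent vectors and of the metric -/

section Coordinates

variable {M : Type*} [TopologicalSpace M] [ChartedSpace H M] [IsManifold I ∞ M]

variable (I) in
/-- The coordinates of a tangent vector at `x` in the preferred chart at `q`; zero when `x` is not
in the domain of that chart. -/
def coords (q x : M) : TangentSpace I x →L[ℝ] 𝔼 :=
  (trivializationAt 𝔼 (TangentSpace I) q).continuousLinearMapAt ℝ x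

variable (I) in
/-- The coordinate vector field `coordField`, as a continuous linear map in its coefficients. -/
def coordFieldL (q x : M) : 𝔼 →L[ℝ] TangentSpace I x :=
  (trivializationAt 𝔼 (TangentSpace I) q).symmL ℝ x

lemma coordFieldL_apply (q x : M) (u : 𝔼) : coordFieldL I q x u = coordField I q u x := rfl

lemma coords_apply {q x : M} (hx : x ∈ (chartAt H q).source) (v : TangentSpace I x) :
    coords I q x v = (trivializationAt 𝔼 (TangentSpace I) q ⟨x, v⟩).2 := by
  rw [coords, Trivialization.continuousLinearMapAt_apply, Trivialization.linearMapAt_apply, if_pos]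
  simpa using hx

@[simp]
lemma coordFieldL_coords {q x : M} (hx : x ∈ (chartAt H q).source) (v : TangentSpace I x) :
    coordFieldL I q x (coords I q x v) = v :=
  (trivializationAt 𝔼 (TangentSpace I) q).symmL_continuousLinearMapAt (by simpa using hx) v

@[simp]
lemma coords_coordFieldL {q x : M} (hx : x ∈ (chartAt H q).source) (u : 𝔼) :
    coords I q x (coordFieldL I q x u) = u :=
  (trivializationAt 𝔼 (TangentSpace I) q).continuousLinearMapAt_symmL (by simpa using hx) u

variable (I) in
/-- The isomorphism `coords` at a point of the domain of the chart, with inverse `coordFieldL`. -/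
def coordsEquiv {q x : M} (hx : x ∈ (chartAt H q).source) : TangentSpace I x ≃L[ℝ] 𝔼 :=
  .equivOfInverse (coords I q x) (coordFieldL I q x) (coordFieldL_coords hx) (coords_coordFieldL hx)

@[simp]
lemma coords_self (q : M) (v : TangentSpace I q) : coords I q q v = v := by
  rw [coords, TangentBundle.continuousLinearMapAt_trivializationAt_eq_core (by simp)]
  exact (tangentBundleCore I M).coordChange_self (achart H q) q (mem_chart_source H q) v

@[simp]
lemma coordFieldL_self (q : M) (u : 𝔼) : coordFieldL I q q u = u := by
  rw [← coords_self q (coordFieldL I q q u), coords_coordFieldL (mem_chart_source H q)]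

lemma contMDiffAt_coordField {q x : M} (hx : x ∈ (chartAt H q).source) (u : 𝔼) :
    ContMDiffAt I I.tangent ∞ (fun x ↦ (⟨x, coordField I q u x⟩ : TangentBundle I M)) x := by
  rw [(trivializationAt 𝔼 (TangentSpace I) q).contMDiffAt_section_iff (by simpa using hx)]
  refine contMDiffAt_const (c := u) |>.congr_of_eventuallyEq ?_
  filter_upwards [(chartAt H q).open_source.mem_nhds hx] with y hy
  rw [← coords_apply hy, ← coordFieldL_apply, coords_coordFieldL hy]

lemma contMDiffAt_along_iff {N : Type*} [TopologicalSpace N] [ChartedSpace H N]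
    {n : WithTop ℕ∞} (hn : n ≤ ∞) {f : N → M} {ξ : ∀ x, TangentSpace I (f x)} {x : N} {b : M}
    (hb : f x ∈ (chartAt H b).source) :
    ContMDiffAt I I.tangent n (fun x ↦ (⟨f x, ξ x⟩ : TangentBundle I M)) x ↔
      ContMDiffAt I I n f x ∧ ContMDiffAt I 𝓘(ℝ, 𝔼) n (fun x ↦ coords I b (f x) (ξ x)) x := by
  have : ContMDiffVectorBundle n 𝔼 (TangentSpace I : M → Type _) I := .of_le hn
  rw [(trivializationAt 𝔼 (TangentSpace I) b).contMDiffAt_iff (by simpa using hb)]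
  refine and_congr_right fun hf ↦ Filter.EventuallyEq.contMDiffAt_iff ?_
  filter_upwards [hf.continuousAt.preimage_mem_nhds ((chartAt H b).open_source.mem_nhds hb)]
    with y hy
  exact (coords_apply hy (ξ y)).symm

lemma hasMFDerivWithinAt_extChartAt_symm {x a : M} (hx : x ∈ (chartAt H a).source) :
    HasMFDerivWithinAt 𝓘(ℝ, 𝔼) I (extChartAt I a).symm (Set.range I) (extChartAt I a x)
      (coordFieldL I a x) := by
  rw [coordFieldL, TangentBundle.symmL_trivializationAt hx]
  exact (mdifferentiableWithinAt_extChartAt_symm (I := I) (x := a)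
    ((extChartAt I a).map_source (by simpa using hx))).hasMFDerivWithinAt

lemma hasMFDerivAt_extChartAt_coords {x a : M} (hx : x ∈ (chartAt H a).source) :
    HasMFDerivAt I 𝓘(ℝ, 𝔼) (extChartAt I a) x (coords I a x) := by
  rw [coords, TangentBundle.continuousLinearMapAt_trivializationAt hx]
  exact (mdifferentiableAt_extChartAt hx).hasMFDerivAt

lemma hasFDerivWithinAt_comp_extChartAt_symm {G : Type*} [NormedAddCommGroup G] [NormedSpace ℝ G]
    {h : M → G} {x a : M} (hx : x ∈ (chartAt H a).source) {h' : TangentSpace I x →L[ℝ] G}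
    (hh : HasMFDerivAt I 𝓘(ℝ, G) h x h') :
    HasFDerivWithinAt (h ∘ (extChartAt I a).symm) (h' ∘L coordFieldL I a x) (Set.range I)
      (extChartAt I a x) := by
  have hsymm : (extChartAt I a).symm (extChartAt I a x) = x :=
    (extChartAt I a).left_inv (by simpa using hx)
  have hh' : HasMFDerivAt I 𝓘(ℝ, G) h ((extChartAt I a).symm (extChartAt I a x)) h' := by
    rwa [hsymm]
  exact hasMFDerivWithinAt_iff_hasFDerivWithinAt.1
    (hh'.comp_hasMFDerivWithinAt _ (hasMFDerivWithinAt_extChartAt_symm hx))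

lemma hasFDerivWithinAt_writtenInCharts {M' : Type*} [TopologicalSpace M'] [ChartedSpace H M']
    [IsManifold I ∞ M'] {f : M → M'} {x a : M} {b : M'}
    (hf : MDifferentiableAt I I f x) (hx : x ∈ (chartAt H a).source)
    (hfx : f x ∈ (chartAt H b).source) :
    HasFDerivWithinAt (extChartAt I b ∘ f ∘ (extChartAt I a).symm)
      (coords I b (f x) ∘L mfderiv I I f x ∘L coordFieldL I a x) (Set.range I)
      (extChartAt I a x) :=
  hasFDerivWithinAt_comp_extChartAt_symm hx
    ((hasMFDerivAt_extChartAt_coords hfx).comp x hf.hasMFDerivAt)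

end Coordinates

section Gram

lemma basis_det_comp_single {V : Type*} [AddCommGroup V] [Module ℝ V]
    (e : Basis (Fin d) ℝ V) (L : 𝔼 →ₗ[ℝ] V) (J : 𝔼 →ₗ[ℝ] 𝔼) :
    e.det (fun i ↦ L (J (EuclideanSpace.single i 1))) =
      LinearMap.det J * e.det fun i ↦ L (EuclideanSpace.single i 1) := by
  let b := (EuclideanSpace.basisFun (Fin d) ℝ).toBasis
  have hJ : b.det (J ∘ b) = LinearMap.det J := by rw [b.det_comp, b.det_self, mul_one]
  have h := congrArg (· (J ∘ b)) ((e.det.compLinearMap L).eq_smul_basis_det b)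
  simp only [AlternatingMap.smul_apply, hJ] at h
  simpa [b, Function.comp_def, mul_comm] using h

variable {V : Type*} [NormedAddCommGroup V] [InnerProductSpace ℝ V]

lemma det_gram_eq_sq (e : OrthonormalBasis (Fin d) ℝ V) (v : Fin d → V) :
    (Matrix.gram ℝ v).det = e.toBasis.det v ^ 2 := by
  rw [Matrix.gram_eq_conjTranspose_mul e v, Matrix.det_mul,
    Matrix.conjTranspose_eq_transpose_of_trivial, Matrix.det_transpose, ← sq]
  rfl

lemma det_inner_apply (G : V →ₗ[ℝ] V) (b : Basis (Fin d) ℝ V) :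
    (Matrix.of fun i j ↦ inner ℝ (G (b i)) (b j)).det =
      LinearMap.det G * (Matrix.gram ℝ b).det := by
  rw [← LinearMap.det_toMatrix b, ← Matrix.det_transpose (LinearMap.toMatrix b b G),
    ← Matrix.det_mul]
  congr 1
  ext i j
  simp only [Matrix.of_apply, Matrix.mul_apply, Matrix.transpose_apply, LinearMap.toMatrix_apply,
    Matrix.gram_apply]
  conv_lhs => rw [← b.sum_repr (G (b _)), sum_inner]
  simp only [real_inner_smul_left]

lemma volumeForm_pos_iff [NeZero d] [Fact (finrank ℝ V = d)] (o : Orientation ℝ V (Fin d))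
    (b : Basis (Fin d) ℝ V) : 0 < o.volumeForm b ↔ b.orientation = o := by
  let e := o.finOrthonormalBasis (NeZero.pos d) Fact.out
  have he : e.toBasis.orientation = o := o.finOrthonormalBasis_orientation _ _
  rw [o.volumeForm_robust e he, ← Basis.orientation_eq_iff_det_pos, he]
  exact eq_comm

end Gram

section Metric

variable {M : Type*} [TopologicalSpace M] [ChartedSpace H M]

lemma contMDiffAt_of_clm_apply {G : Type*} [NormedAddCommGroup G] [NormedSpace ℝ G]
    {n : WithTop ℕ∞} {g : M → 𝔼 →L[ℝ] G} {x : M}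
    (h : ∀ u, ContMDiffAt I 𝓘(ℝ, G) n (fun y ↦ g y u) x) :
    ContMDiffAt I 𝓘(ℝ, 𝔼 →L[ℝ] G) n g x := by
  let b := EuclideanSpace.basisFun (Fin d) ℝ
  have hsum : g = fun y ↦ ∑ i,
      ContinuousLinearMap.smulRightL ℝ 𝔼 G (innerSL ℝ (b i)) (g y (b i)) := by
    ext y u
    conv_lhs => rw [← b.sum_repr' u]
    simp
  rw [hsum]
  exact contMDiffAt_finsetSum fun i _ ↦
    (ContinuousLinearMap.contMDiffAt _).comp x (h (b i))

lemma hasMFDerivAt_clm_comp {F G : Type*} [NormedAddCommGroup F] [NormedSpace ℝ F]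
    [NormedAddCommGroup G] [NormedSpace ℝ G] (L : F →L[ℝ] G) {g : M → F} {x : M}
    {g' : TangentSpace I x →L[ℝ] F} (hg : HasMFDerivAt I 𝓘(ℝ, F) g x g') :
    HasMFDerivAt I 𝓘(ℝ, G) (fun y ↦ L (g y)) x (L ∘L g') :=
  L.hasMFDerivAt.comp x hg

variable [IsManifold I ∞ M]

variable (I) in
/-- The frame of coordinate vector fields of the preferred chart at `q`. -/
def coordFrame (q x : M) (i : Fin d) : TangentSpace I x :=
  coordFieldL I q x (EuclideanSpace.single i 1)

lemma exists_coe_basis_eq_coordFrame {q x : M} (hx : x ∈ (chartAt H q).source) :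
    ∃ b : Basis (Fin d) ℝ (TangentSpace I x), ⇑b = coordFrame I q x := by
  refine ⟨(EuclideanSpace.basisFun (Fin d) ℝ).toBasis.map (coordsEquiv I hx).symm.toLinearEquiv, ?_⟩
  funext i
  simp [coordsEquiv, coordFrame]

variable [RiemannianBundle (fun x : M ↦ TangentSpace I x)]

variable (I) in
/-- The metric at `x` in the preferred chart at `q`, as a bilinear form on the coordinates of
tangent vectors. -/
def metricCoord (q x : M) : 𝔼 →L[ℝ] 𝔼 →L[ℝ] ℝ :=
  (innerSL ℝ (E := TangentSpace I x)).bilinearComp (coordFieldL I q x) (coordFieldL I q x)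

lemma metricCoord_apply (q x : M) (u v : 𝔼) :
    metricCoord I q x u v = inner ℝ (coordFieldL I q x u) (coordFieldL I q x v) := rfl

lemma inner_eq_metricCoord {q x : M} (hx : x ∈ (chartAt H q).source) (v w : TangentSpace I x) :
    inner ℝ v w = metricCoord I q x (coords I q x v) (coords I q x w) := by
  rw [metricCoord_apply, coordFieldL_coords hx, coordFieldL_coords hx]

lemma metricCoord_self (q : M) (u v : TangentSpace I q) : metricCoord I q q u v = inner ℝ u v := by
  rw [inner_eq_metricCoord (mem_chart_source H q), coords_self, coords_self]

variable (I) in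
/-- The density `√(det g)` of the Riemannian volume in the preferred chart at `q`, as a function on
the domain of that chart. -/
def density (q x : M) : ℝ := √(Matrix.gram ℝ (coordFrame I q x)).det

lemma density_eq_abs_det (q : M) {x : M} (e : OrthonormalBasis (Fin d) ℝ (TangentSpace I x)) :
    density I q x = |e.toBasis.det (coordFrame I q x)| := by
  rw [density, det_gram_eq_sq e, Real.sqrt_sq_eq_abs]

lemma det_gram_coordFrame_pos {q x : M} (hx : x ∈ (chartAt H q).source) :
    0 < (Matrix.gram ℝ (coordFrame I q x)).det := by
  obtain ⟨b, hb⟩ := exists_coe_basis_eq_coordFrame (I := I) hx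
  exact (hb ▸ Matrix.posDef_gram_of_linearIndependent b.linearIndependent).det_pos

lemma density_pos {q x : M} (hx : x ∈ (chartAt H q).source) : 0 < density I q x :=
  Real.sqrt_pos.2 (det_gram_coordFrame_pos hx)

lemma density_eq_abs_det_mul (a : M) {b x : M} (hx : x ∈ (chartAt H b).source) :
    density I a x = |(coords I b x ∘L coordFieldL I a x).det| * density I b x := by
  let e := (stdOrthonormalBasis ℝ (TangentSpace I x)).reindex
    (finCongr (Fact.out : finrank ℝ (TangentSpace I x) = d))
  rw [density_eq_abs_det a e, density_eq_abs_det b e, ← abs_mul, ContinuousLinearMap.det]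
  congr 1
  have h := basis_det_comp_single e.toBasis (coordFieldL I b x).toLinearMap
    (coords I b x ∘L coordFieldL I a x).toLinearMap
  simpa [coordFieldL_coords hx] using! h

lemma density_eq_mul_sqrt_det (q x : M) {G : TangentSpace I q →L[ℝ] TangentSpace I q}
    (hG : ∀ u v, inner ℝ (G u) v = metricCoord I q x u v) :
    density I q x = density I q q * √G.det := by
  obtain ⟨b, hb⟩ := exists_coe_basis_eq_coordFrame (I := I) (mem_chart_source H q)
  have hgram : Matrix.gram ℝ (coordFrame I q x) =
      Matrix.of fun i j ↦ inner ℝ (G (b i)) (b j) := by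
    ext i j
    rw [Matrix.of_apply, hG, hb, coordFrame, coordFrame, coordFieldL_self, coordFieldL_self]
    rfl
  rw [density, hgram, ← ContinuousLinearMap.coe_coe, det_inner_apply, hb, mul_comm,
    Real.sqrt_mul (det_gram_coordFrame_pos (mem_chart_source H q)).le]
  rfl

lemma inner_raiseIndex_metricCoord {ι : Type*} [Fintype ι] {q : M}
    (e : OrthonormalBasis ι ℝ (TangentSpace I q)) (x : M) (u v : TangentSpace I q) :
    inner (E := TangentSpace I q) ℝ (raiseIndex (E := 𝔼) e (metricCoord I q x) u) v =
      metricCoord I q x u v := by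
  have hsum : raiseIndex (E := 𝔼) e (metricCoord I q x) u =
      ∑ i, metricCoord I q x (e i) u • e i := raiseIndex_apply _ _ _
  have hv := congrArg (metricCoord I q x · u) (e.sum_repr' v)
  calc inner (E := TangentSpace I q) ℝ (raiseIndex (E := 𝔼) e (metricCoord I q x) u) v
      = inner ℝ (∑ i, metricCoord I q x (e i) u • e i) v := by rw [hsum]
    _ = ∑ i, inner ℝ (e i) v * metricCoord I q x (e i) u := by
      simp only [sum_inner, real_inner_smul_left, mul_comm]
    _ = metricCoord I q x (∑ i, inner ℝ (e i) v • e i : TangentSpace I q) u := by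
      let L : TangentSpace I q →L[ℝ] ℝ := (metricCoord I q x).flip u
      exact ((map_sum L _ _).trans (by simp only [map_smul, smul_eq_mul]; rfl)).symm
    _ = metricCoord I q x u v := hv.trans (real_inner_comm (F := TangentSpace I x) _ _)

lemma raiseIndex_metricCoord_self {ι : Type*} [Fintype ι] {q : M}
    (e : OrthonormalBasis ι ℝ (TangentSpace I q)) :
    raiseIndex (E := 𝔼) e (metricCoord I q q) = .id ℝ 𝔼 := by
  ext1 u
  exact ext_inner_right (E := TangentSpace I q) ℝ fun v ↦
    (inner_raiseIndex_metricCoord e q u v).trans (metricCoord_self q u v)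

lemma metricDeriv_comm (q : M) (w u v : TangentSpace I q) :
    metricDeriv I q w u v = metricDeriv I q w v u := by
  have hsymm : (fun x ↦ inner ℝ (coordField I q u x) (coordField I q v x)) =
      fun x ↦ inner ℝ (coordField I q v x) (coordField I q u x) :=
    funext fun x ↦ real_inner_comm _ _
  unfold metricDeriv
  rw [hsymm]
  rfl

lemma abs_volumeForm_coordFrame [NeZero d] {x : M} (o : Orientation ℝ (TangentSpace I x) (Fin d))
    (q : M) : |o.volumeForm (coordFrame I q x)| = density I q x := by
  let e := o.finOrthonormalBasis (NeZero.pos d) Fact.out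
  rw [density_eq_abs_det q e, o.volumeForm_robust e (o.finOrthonormalBasis_orientation _ _)]

lemma volumeForm_coordFrame_pos_iff [NeZero d] {q x : M}
    (hx : x ∈ (trivializationAt 𝔼 (TangentSpace I) q).baseSet)
    (o : Orientation ℝ (TangentSpace I x) (Fin d)) :
    0 < o.volumeForm (coordFrame I q x) ↔
      Orientation.map (Fin d) ((trivializationAt 𝔼 (TangentSpace I) q).linearEquivAt ℝ x hx) o =
        (EuclideanSpace.basisFun (Fin d) ℝ).toBasis.orientation := by
  let L := (trivializationAt 𝔼 (TangentSpace I) q).linearEquivAt ℝ x hx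
  let b := (EuclideanSpace.basisFun (Fin d) ℝ).toBasis
  have hb : ⇑(b.map L.symm) = coordFrame I q x := by
    funext i
    have hx' : x ∈ (chartAt H q).source := by simpa using hx
    rw [Basis.map_apply, LinearEquiv.symm_apply_eq, OrthonormalBasis.coe_toBasis,
      EuclideanSpace.basisFun_apply, ← coords_coordFieldL (I := I) hx' (EuclideanSpace.single i 1),
      coords_apply hx']
    rfl
  rw [← hb, volumeForm_pos_iff, Basis.orientation_map, ← Orientation.map_symm,
    Equiv.symm_apply_eq]
  exact eq_comm

lemma exists_sign_volumeForm_coordFrame [NeZero d] (o : ManifoldOrientation I M) (q : M) :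
    ∃ s : ℝ, s * s = 1 ∧
      ∀ᶠ x in 𝓝 q, (o.at' x).volumeForm (coordFrame I q x) = s * density I q x := by
  have hconst : ∀ᶠ x in 𝓝 q, (0 < (o.at' x).volumeForm (coordFrame I q x) ↔
      0 < (o.at' q).volumeForm (coordFrame I q q)) := by
    filter_upwards [o.locallyConstant q,
      (trivializationAt 𝔼 (TangentSpace I) q).open_baseSet.mem_nhds
        (mem_baseSet_trivializationAt 𝔼 (TangentSpace I) q)] with x hloc hx
    rw [volumeForm_coordFrame_pos_iff hx, hloc hx, volumeForm_coordFrame_pos_iff]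
  by_cases hq : 0 < (o.at' q).volumeForm (coordFrame I q q)
  · refine ⟨1, one_mul 1, hconst.mono fun x hx ↦ ?_⟩
    rw [one_mul, ← abs_volumeForm_coordFrame (o.at' x), abs_of_pos (hx.2 hq)]
  · refine ⟨-1, by norm_num, hconst.mono fun x hx ↦ ?_⟩
    rw [← abs_volumeForm_coordFrame (o.at' x), abs_of_nonpos (not_lt.1 (hx.not.2 hq)), neg_mul_neg,
      one_mul]

variable [IsContMDiffRiemannianBundle I 1 (EuclideanSpace ℝ (Fin d)) (fun x : M ↦ TangentSpace I x)]

lemma contMDiffAt_metricCoord {q x : M} (hx : x ∈ (chartAt H q).source) :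
    ContMDiffAt I 𝓘(ℝ, 𝔼 →L[ℝ] 𝔼 →L[ℝ] ℝ) 1 (metricCoord I q) x :=
  contMDiffAt_of_clm_apply fun u ↦ contMDiffAt_of_clm_apply fun v ↦
    ContMDiffAt.inner_bundle (F := 𝔼) (E := fun x : M ↦ TangentSpace I x)
      ((contMDiffAt_coordField hx u).of_le (by simp))
      ((contMDiffAt_coordField hx v).of_le (by simp))

lemma contMDiffAt_density {q x : M} (hx : x ∈ (chartAt H q).source) :
    ContMDiffAt I 𝓘(ℝ, ℝ) 1 (density I q) x := by
  have hentry (i j : Fin d) :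
      ContMDiffAt I 𝓘(ℝ, ℝ) 1 (fun y ↦ Matrix.gram ℝ (coordFrame I q y) i j) x :=
    ((contMDiffAt_metricCoord hx).clm_apply contMDiffAt_const).clm_apply contMDiffAt_const
  have hdet : ContMDiffAt I 𝓘(ℝ, ℝ) 1 (fun y ↦ (Matrix.gram ℝ (coordFrame I q y)).det) x := by
    simp_rw [Matrix.det_apply']
    exact contMDiffAt_finsetSum fun σ _ ↦
      contMDiffAt_const.mul (contMDiffAt_finsetProd fun i _ ↦ hentry _ _)
  exact (Real.contDiffAt_sqrt (det_gram_coordFrame_pos hx).ne').contMDiffAt.comp x hdet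

variable (I) in
/-- The derivative at `q` of the metric in the chart at `q`: `metricDeriv` as a continuous
multilinear map. -/
def metricDerivL (q : M) :
    TangentSpace I q →L[ℝ] TangentSpace I q →L[ℝ] TangentSpace I q →L[ℝ] ℝ :=
  mfderiv I 𝓘(ℝ, 𝔼 →L[ℝ] 𝔼 →L[ℝ] ℝ) (metricCoord I q) q

lemma hasMFDerivAt_metricCoord_self (q : M) :
    HasMFDerivAt I 𝓘(ℝ, 𝔼 →L[ℝ] 𝔼 →L[ℝ] ℝ) (metricCoord I q) q (metricDerivL I q) :=
  ((contMDiffAt_metricCoord (mem_chart_source H q)).mdifferentiableAt one_ne_zero).hasMFDerivAt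

lemma metricDerivL_apply (q : M) (w u v : TangentSpace I q) :
    metricDerivL I q w u v = metricDeriv I q w u v :=
  let u' : 𝔼 := u
  let v' : 𝔼 := v
  (congrArg (· w) (hasMFDerivAt_clm_comp
    (ContinuousLinearMap.apply ℝ ℝ v' ∘L ContinuousLinearMap.apply ℝ (𝔼 →L[ℝ] ℝ) u')
    (hasMFDerivAt_metricCoord_self q)).mfderiv).symm

lemma mfderiv_density_self {ι : Type*} [Fintype ι] {q : M}
    (e : OrthonormalBasis ι ℝ (TangentSpace I q)) (w : TangentSpace I q) :
    mfderiv I 𝓘(ℝ, ℝ) (density I q) q w =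
      density I q q / 2 * ∑ i, metricDeriv I q w (e i) (e i) := by
  have hsqrt := (hasFDerivAt_sqrt_det_id (E := 𝔼)).const_mul (density I q q)
  rw [← raiseIndex_metricCoord_self e] at hsqrt
  have h := hsqrt.hasMFDerivAt.comp q
    (hasMFDerivAt_clm_comp (raiseIndex (E := 𝔼) e) (hasMFDerivAt_metricCoord_self q))
  have hdensity : density I q = (fun A : 𝔼 →L[ℝ] 𝔼 ↦ density I q q * √A.det) ∘
      fun x ↦ raiseIndex (E := 𝔼) e (metricCoord I q x) :=
    funext fun x ↦ density_eq_mul_sqrt_det q x (inner_raiseIndex_metricCoord e x)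
  rw [← hdensity] at h
  have htrace : traceCLM 𝔼 (raiseIndex (E := 𝔼) e (metricDerivL I q w)) =
      ∑ i, metricDeriv I q w (e i) (e i) :=
    (trace_raiseIndex (E := 𝔼) e _).trans
      (Finset.sum_congr rfl fun i _ ↦ metricDerivL_apply q w _ _)
  exact (congrArg (· w) h.mfderiv).trans
    ((congrArg (fun t : ℝ ↦ density I q q * (1 / 2 * t)) htrace).trans (by ring))

end Metric

/-! ### The Levi-Civita connection along a map -/

section Connection

lemma inner_sum_apply_smul {V ι : Type*} [NormedAddCommGroup V] [InnerProductSpace ℝ V] [Fintype ι]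
    (e : OrthonormalBasis ι ℝ V) (ℓ : V →ₗ[ℝ] ℝ) (w : V) :
    inner ℝ (∑ i, ℓ (e i) • e i) w = ℓ w := by
  conv_rhs => rw [← e.sum_repr' w]
  simp only [sum_inner, real_inner_smul_left, map_sum, map_smul, smul_eq_mul, mul_comm]

lemma hasMFDerivAt_clm_apply {M : Type*} [TopologicalSpace M] [ChartedSpace H M]
    {F G : Type*} [NormedAddCommGroup F] [NormedSpace ℝ F] [NormedAddCommGroup G] [NormedSpace ℝ G]
    {c : M → F →L[ℝ] G} {u : M → F} {x : M} {c' : TangentSpace I x →L[ℝ] F →L[ℝ] G}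
    {u' : TangentSpace I x →L[ℝ] F} (hc : HasMFDerivAt I 𝓘(ℝ, F →L[ℝ] G) c x c')
    (hu : HasMFDerivAt I 𝓘(ℝ, F) u x u') :
    HasMFDerivAt I 𝓘(ℝ, G) (fun y ↦ c y (u y)) x
      (c x ∘L u' + ContinuousLinearMap.apply ℝ G (u x) ∘L c') := by
  have happly := (hasFDerivAt_fst (𝕜 := ℝ) (p := (c x, u x))).clm_apply hasFDerivAt_snd
  have hpair : HasMFDerivAt I 𝓘(ℝ, (F →L[ℝ] G) × F) (fun y ↦ (c y, u y)) x (c'.prod u') :=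
    ⟨hc.1.prodMk hu.1, hc.2.prodMk hu.2⟩
  exact happly.hasMFDerivAt.comp x hpair

lemma eventually_mem_chart_source {N M : Type*} [TopologicalSpace N] [TopologicalSpace M]
    [ChartedSpace H M] {f : N → M} {p : N} (hf : ContinuousAt f p) :
    ∀ᶠ x in 𝓝 p, f x ∈ (chartAt H (f p)).source :=
  hf.preimage_mem_nhds ((chartAt H (f p)).open_source.mem_nhds (mem_chart_source H (f p)))

section Christoffel

variable {M : Type*} [TopologicalSpace M] [ChartedSpace H M] [IsManifold I ∞ M]
  [RiemannianBundle (fun x : M ↦ TangentSpace I x)]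
  [IsContMDiffRiemannianBundle I 1 (EuclideanSpace ℝ (Fin d)) (fun x : M ↦ TangentSpace I x)]

lemma inner_christoffel (q : M) (u v w : TangentSpace I q) :
    inner ℝ (christoffel I q u v) w = (1 / 2 : ℝ) *
      (metricDeriv I q u v w + metricDeriv I q v u w - metricDeriv I q w u v) := by
  let ℓ : TangentSpace I q →L[ℝ] ℝ :=
    let ev : (TangentSpace I q →L[ℝ] TangentSpace I q →L[ℝ] ℝ) →L[ℝ] ℝ :=
      ContinuousLinearMap.apply ℝ ℝ v ∘L ContinuousLinearMap.apply ℝ (TangentSpace I q →L[ℝ] ℝ) u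
    (1 / 2 : ℝ) • (metricDerivL I q u v + metricDerivL I q v u - ev ∘L metricDerivL I q)
  have hℓ w : ℓ w = (1 / 2 : ℝ) *
      (metricDeriv I q u v w + metricDeriv I q v u w - metricDeriv I q w u v) := by
    rw [← metricDerivL_apply, ← metricDerivL_apply, ← metricDerivL_apply]
    rfl
  rw [← hℓ]
  refine Eq.trans (congrArg (inner ℝ · w) ?_)
    (inner_sum_apply_smul (stdOrthonormalBasis ℝ (TangentSpace I q)) ℓ.toLinearMap w)
  exact Finset.sum_congr rfl fun i _ ↦ congrArg (· • _) (hℓ _).symm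

lemma inner_christoffel_add (q : M) (u v w : TangentSpace I q) :
    inner ℝ (christoffel I q u v) w + inner ℝ v (christoffel I q u w) = metricDeriv I q u v w := by
  rw [real_inner_comm (christoffel I q u w) v, inner_christoffel, inner_christoffel,
    metricDeriv_comm q u w v]
  ring

variable (I) in
/-- The Christoffel symbol `Γ(·, v)` as a linear map in its first argument. -/
def christoffelL (q : M) (v : TangentSpace I q) : TangentSpace I q →L[ℝ] TangentSpace I q :=
  LinearMap.toContinuousLinearMap
    { toFun u := christoffel I q u v
      map_add' u u' := by
        refine ext_inner_right ℝ fun w ↦ ?_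
        simp only [inner_add_left, inner_christoffel, ← metricDerivL_apply,
          ContinuousLinearMap.map_add, add_apply]
        ring
      map_smul' c u := by
        refine ext_inner_right ℝ fun w ↦ ?_
        simp only [inner_smul_left, inner_christoffel, ← metricDerivL_apply,
          ContinuousLinearMap.map_smul, smul_apply, smul_eq_mul, conj_trivial, RingHom.id_apply]
        ring }

lemma christoffelL_apply (q : M) (u v : TangentSpace I q) :
    christoffelL I q v u = christoffel I q u v := rfl

lemma density_mul_trace_christoffelL (q : M) (v : TangentSpace I q) :
    density I q q * LinearMap.trace ℝ (TangentSpace I q) (christoffelL I q v) =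
      mfderiv I 𝓘(ℝ, ℝ) (density I q) q v := by
  let e := stdOrthonormalBasis ℝ (TangentSpace I q)
  have hdiag i : inner ℝ (e i) (christoffelL I q v (e i)) =
      (1 / 2 : ℝ) * metricDeriv I q v (e i) (e i) := by
    rw [real_inner_comm, christoffelL_apply, inner_christoffel, metricDeriv_comm q (e i) v]
    ring
  refine Eq.trans ?_ (mfderiv_density_self e v).symm
  rw [LinearMap.trace_eq_sum_inner _ e, div_mul_eq_mul_div, mul_div_assoc, Finset.sum_div]
  congr 1
  refine Finset.sum_congr rfl fun i _ ↦ (hdiag i).trans ?_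
  ring

end Christoffel

section CovariantDerivative

variable {M₁ : Type*} [TopologicalSpace M₁] [ChartedSpace H M₁]
  {M₂ : Type*} [TopologicalSpace M₂] [ChartedSpace H M₂] [IsManifold I ∞ M₂]

variable (I) in
/-- A section of `f^*TM₂` is differentiable at `p` if its coordinates in the chart of `M₂` at `f p`
are. -/
def DifferentiableSectionAt (f : M₁ → M₂) (ξ : ∀ x, TangentSpace I (f x)) (p : M₁) : Prop :=
  MDifferentiableAt I 𝓘(ℝ, 𝔼) (fun x ↦ coords I (f p) (f x) (ξ x)) p

lemma differentiableSectionAt_of_contMDiffAt {f : M₁ → M₂} {ξ : ∀ x, TangentSpace I (f x)} {p : M₁}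
    (hξ : ContMDiffAt I I.tangent 1 (fun x ↦ (⟨f x, ξ x⟩ : TangentBundle I M₂)) p) :
    DifferentiableSectionAt I f ξ p :=
  ((contMDiffAt_along_iff (by simp) (mem_chart_source H (f p))).1 hξ).2.mdifferentiableAt
    one_ne_zero

variable [RiemannianBundle (fun x : M₂ ↦ TangentSpace I x)]
  [IsContMDiffRiemannianBundle I 1 (EuclideanSpace ℝ (Fin d)) (fun x : M₂ ↦ TangentSpace I x)]
  {f : M₁ → M₂} {ξ η : ∀ x, TangentSpace I (f x)} {p : M₁}

variable (I) in
/-- The covariant derivative `covDerivAlong`, as a continuous linear map in the direction. -/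
def covDerivAlongL (f : M₁ → M₂) (ξ : ∀ x, TangentSpace I (f x)) (p : M₁) :
    TangentSpace I p →L[ℝ] TangentSpace I (f p) :=
  coordFieldL I (f p) (f p) ∘L
      mfderiv I 𝓘(ℝ, 𝔼) (fun x ↦ coords I (f p) (f x) (ξ x)) p
    + christoffelL I (f p) (ξ p) ∘L mfderiv I I f p

lemma exists_hasMFDerivAt_inner (hf : MDifferentiableAt I I f p)
    (hξ : DifferentiableSectionAt I f ξ p) (hη : DifferentiableSectionAt I f η p) :
    ∃ D : TangentSpace I p →L[ℝ] ℝ,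
      HasMFDerivAt I 𝓘(ℝ, ℝ) (fun x ↦ inner ℝ (ξ x) (η x)) p D ∧ ∀ v, D v =
        inner ℝ (covDerivAlong I f ξ p v) (η p) + inner ℝ (ξ p) (covDerivAlong I f η p v) := by
  have h := hasMFDerivAt_clm_apply (hasMFDerivAt_clm_apply
    ((hasMFDerivAt_metricCoord_self (f p)).comp p hf.hasMFDerivAt) hξ.hasMFDerivAt)
    hη.hasMFDerivAt
  refine ⟨_, h.congr_of_eventuallyEq ((eventually_mem_chart_source hf.continuousAt).mono
    fun x hx ↦ inner_eq_metricCoord hx _ _), fun v ↦ ?_⟩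
  let ξ' : TangentSpace I (f p) := mfderiv I 𝓘(ℝ, 𝔼) (fun x ↦ coords I (f p) (f x) (ξ x)) p v
  let η' : TangentSpace I (f p) := mfderiv I 𝓘(ℝ, 𝔼) (fun x ↦ coords I (f p) (f x) (η x)) p v
  let w := mfderiv I I f p v
  have hξη : metricDerivL I (f p) w (ξ p) (η p) =
      inner ℝ (christoffel I (f p) w (ξ p)) (η p) + inner ℝ (ξ p) (christoffel I (f p) w (η p)) :=
    (metricDerivL_apply _ _ _ _).trans (inner_christoffel_add _ _ _ _).symm
  have hξ' : covDerivAlong I f ξ p v = ξ' + christoffel I (f p) w (ξ p) :=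
    congrArg (· + _) (coordFieldL_self _ _)
  have hη' : covDerivAlong I f η p v = η' + christoffel I (f p) w (η p) :=
    congrArg (· + _) (coordFieldL_self _ _)
  rw [hξ', hη', inner_add_left, inner_add_right]
  calc _ = metricCoord I (f p) (f p) (coords I (f p) (f p) (ξ p)) η' +
        (metricCoord I (f p) (f p) ξ' (coords I (f p) (f p) (η p)) +
          metricDerivL I (f p) w (coords I (f p) (f p) (ξ p)) (coords I (f p) (f p) (η p))) := rfl
    _ = inner ℝ (ξ p) η' + (inner ℝ ξ' (η p) + metricDerivL I (f p) w (ξ p) (η p)) := by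
      rw [coords_self, coords_self]
      exact congrArg₂ _ (metricCoord_self _ _ _) (congrArg (· + _) (metricCoord_self _ _ _))
    _ = _ := by rw [hξη]; ring

lemma density_mul_trace_conj_christoffelL (e : TangentSpace I p ≃L[ℝ] TangentSpace I (f p))
    (v : TangentSpace I (f p)) :
    density I (f p) (f p) * LinearMap.trace ℝ (TangentSpace I p)
        (e.symm.toLinearMap ∘ₗ (christoffelL I (f p) v).toLinearMap ∘ₗ e.toLinearMap) =
      mfderiv I 𝓘(ℝ, ℝ) (density I (f p)) (f p) v := by
  rw [← density_mul_trace_christoffelL]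
  congr 1
  exact LinearMap.trace_conj' (christoffelL I (f p) v).toLinearMap e.symm.toLinearEquiv

lemma exists_hasMFDerivAt_density_smul_coords (hf : MDifferentiableAt I I f p)
    (hξ : DifferentiableSectionAt I f ξ p) {e : TangentSpace I p ≃L[ℝ] TangentSpace I (f p)}
    (he : mfderiv I I f p = e) :
    ∃ D : TangentSpace I p →L[ℝ] 𝔼,
      HasMFDerivAt I 𝓘(ℝ, 𝔼)
        (fun x ↦ density I (f p) (f x) • coords I (f p) (f x) (ξ x)) p D ∧
      LinearMap.trace ℝ (TangentSpace I p)
          (e.symm.toContinuousLinearMap ∘L coordFieldL I (f p) (f p) ∘L D) =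
        density I (f p) (f p) * LinearMap.trace ℝ (TangentSpace I p)
          (e.symm.toContinuousLinearMap ∘L covDerivAlongL I f ξ p) := by
  let ρ := density I (f p)
  let ρ' : TangentSpace I (f p) →L[ℝ] ℝ := mfderiv I 𝓘(ℝ, ℝ) ρ (f p)
  let ξ' : TangentSpace I p →L[ℝ] 𝔼 := mfderiv I 𝓘(ℝ, 𝔼) (fun x ↦ coords I (f p) (f x) (ξ x)) p
  have hρ : HasMFDerivAt I 𝓘(ℝ, ℝ) (fun x ↦ ρ (f x)) p (ρ' ∘L mfderiv I I f p) :=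
    ((contMDiffAt_density (mem_chart_source H (f p))).mdifferentiableAt
      one_ne_zero).hasMFDerivAt.comp p hf.hasMFDerivAt
  have hcoords := hasMFDerivAt_clm_apply
    (hasMFDerivAt_clm_comp (ContinuousLinearMap.lsmul ℝ ℝ (E := 𝔼)) hρ) hξ.hasMFDerivAt
  refine ⟨_, hcoords, ?_⟩
  have hD : e.symm.toContinuousLinearMap ∘L coordFieldL I (f p) (f p) ∘L
      (ContinuousLinearMap.lsmul ℝ ℝ (ρ (f p)) ∘L ξ' +
        ContinuousLinearMap.apply ℝ 𝔼 (coords I (f p) (f p) (ξ p)) ∘L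
          ContinuousLinearMap.lsmul ℝ ℝ ∘L ρ' ∘L mfderiv I I f p) =
      ρ (f p) • (e.symm.toContinuousLinearMap ∘L coordFieldL I (f p) (f p) ∘L ξ') +
        (ρ' ∘L e.toContinuousLinearMap).smulRight (e.symm (ξ p)) := by
    ext v
    simp only [he, coordFieldL_self, ContinuousLinearMap.comp_apply, add_apply, smul_apply,
      ContinuousLinearMap.smulRight_apply]
    exact (map_add e.symm _ _).trans <| congrArg₂ (· + ·) (map_smul e.symm _ _)
      ((map_smul e.symm (ρ' (e v)) (coords I (f p) (f p) (ξ p))).trans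
        (congrArg (fun u ↦ ρ' (e v) • e.symm u) (coords_self _ _)))
  have hρ' : LinearMap.trace ℝ (TangentSpace I p)
      ((ρ' ∘L e.toContinuousLinearMap).smulRight (e.symm (ξ p))).toLinearMap =
        ρ (f p) * LinearMap.trace ℝ (TangentSpace I p)
          (e.symm.toLinearMap ∘ₗ (christoffelL I (f p) (ξ p)).toLinearMap ∘ₗ e.toLinearMap) := by
    rw [density_mul_trace_conj_christoffelL]
    exact (LinearMap.trace_smulRight _ _).trans (congrArg ρ' (e.apply_symm_apply _))
  refine (congrArg (fun A : _ →L[ℝ] _ ↦ LinearMap.trace ℝ (TangentSpace I p) A) hD).trans ?_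
  rw [ContinuousLinearMap.toLinearMap_add, ContinuousLinearMap.toLinearMap_smul, map_add, map_smul,
    hρ', smul_eq_mul, ← mul_add, ← map_add, covDerivAlongL, he,
    ContinuousLinearMap.comp_add]
  rfl

end CovariantDerivative

end Connection

/-! ### The Piola transform and the divergence -/

section Piola

lemma tendsto_extChartAt_symm {M : Type*} [TopologicalSpace M] [ChartedSpace H M] {a x : M}
    (hx : x ∈ (chartAt H a).source) :
    Filter.Tendsto (extChartAt I a).symm (𝓝[Set.range I] extChartAt I a x) (𝓝 x) :=
  (map_extChartAt_symm_nhdsWithin_range' (by simpa using hx)).le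

section CoordinateDifferential

variable {M₁ : Type*} [TopologicalSpace M₁] [ChartedSpace H M₁] [IsManifold I ∞ M₁]
  {M₂ : Type*} [TopologicalSpace M₂] [ChartedSpace H M₂] [IsManifold I ∞ M₂]
  {f : M₁ → M₂} {a x : M₁} {b : M₂}

variable (I) in
/-- The differential of `f` at `x` in the preferred charts at `a` and at `b`. -/
def mfderivCoord (f : M₁ → M₂) (a : M₁) (b : M₂) (x : M₁) : 𝔼 →L[ℝ] 𝔼 :=
  coords I b (f x) ∘L mfderiv I I f x ∘L coordFieldL I a x

lemma contMDiffAt_mfderivCoord {m n : WithTop ℕ∞} (hf : ContMDiffAt I I n f x) (hmn : m + 1 ≤ n)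
    (hn : n ≤ ∞) :
    ContMDiffAt I 𝓘(ℝ, 𝔼 →L[ℝ] 𝔼) m (mfderivCoord I f x (f x)) x :=
  have : IsManifold I n M₁ := .of_le hn
  have : IsManifold I n M₂ := .of_le hn
  hf.mfderiv_const hmn

lemma fderivWithin_eventuallyEq_mfderivCoord (hf : ContMDiffAt I I 1 f x)
    (hx : x ∈ (chartAt H a).source) (hfx : f x ∈ (chartAt H b).source) :
    fderivWithin ℝ (extChartAt I b ∘ f ∘ (extChartAt I a).symm) (Set.range I)
      =ᶠ[𝓝[Set.range I] extChartAt I a x] mfderivCoord I f a b ∘ (extChartAt I a).symm := by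
  filter_upwards [tendsto_extChartAt_symm hx ((contMDiffAt_iff_contMDiffAt_nhds (by simp)).1 hf),
    tendsto_extChartAt_symm hx ((chartAt H a).open_source.mem_nhds hx),
    tendsto_extChartAt_symm hx
      (hf.continuousAt.preimage_mem_nhds ((chartAt H b).open_source.mem_nhds hfx)),
    extChartAt_target_mem_nhdsWithin' (by simpa using hx)] with y hf' ha hb hy
  have h := hasFDerivWithinAt_writtenInCharts (ContMDiffAt.mdifferentiableAt hf' one_ne_zero) ha hb
  rw [(extChartAt I a).right_inv hy] at h
  exact h.fderivWithin (I.uniqueDiffOn _ (extChartAt_target_subset_range a hy))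

variable (I) in
/-- The differential `mfderivCoord` of a map with invertible differential, as an isomorphism. -/
def mfderivCoordEquiv (hx : x ∈ (chartAt H a).source) (hfx : f x ∈ (chartAt H b).source)
    (e : TangentSpace I x ≃L[ℝ] TangentSpace I (f x)) : 𝔼 ≃L[ℝ] 𝔼 :=
  ((coordsEquiv I hx).symm.trans e).trans (coordsEquiv I hfx)

lemma mfderivCoord_eq_equiv (hx : x ∈ (chartAt H a).source) (hfx : f x ∈ (chartAt H b).source)
    {e : TangentSpace I x ≃L[ℝ] TangentSpace I (f x)} (he : mfderiv I I f x = e) :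
    mfderivCoord I f a b x = mfderivCoordEquiv I hx hfx e := by
  rw [mfderivCoord, he]
  rfl

lemma contDiffWithinAt_writtenInCharts (hf : ContMDiffAt I I 2 f x)
    (hx : x ∈ (chartAt H a).source) (hfx : f x ∈ (chartAt H b).source) :
    ContDiffWithinAt ℝ 2 (extChartAt I b ∘ f ∘ (extChartAt I a).symm) (Set.range I)
      (extChartAt I a x) :=
  ((contMDiffAt_iff_of_mem_source hx hfx).1 hf).2

variable [RiemannianBundle (fun x : M₂ ↦ TangentSpace I x)]

variable (I) in
/-- The coordinates, in the chart of `M₁` at `a`, of `det(df) df⁻¹ (ρ ξ)`: the differential and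
the section `ξ` of `f^*TM₂` are read in the charts at `a` and `b`, and `ρ` is the density at
`b`. -/
def piolaTransform (f : M₁ → M₂) (a : M₁) (b : M₂) (ξ : ∀ x, TangentSpace I (f x)) (x : M₁) : 𝔼 :=
  (mfderivCoord I f a b x).det •
    (mfderivCoord I f a b x).inverse (density I b (f x) • coords I b (f x) (ξ x))

variable [IsContMDiffRiemannianBundle I 1 (EuclideanSpace ℝ (Fin d))
    (fun x : M₂ ↦ TangentSpace I x)] {ξ : ∀ x, TangentSpace I (f x)}

lemma exists_hasFDerivWithinAt_piolaTransform (hx : x ∈ (chartAt H a).source)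
    (hf : ContMDiffAt I I 2 f x) {e : TangentSpace I x ≃L[ℝ] TangentSpace I (f x)}
    (he : mfderiv I I f x = e) (hξ : DifferentiableSectionAt I f ξ x) :
    ∃ V' : 𝔼 →L[ℝ] 𝔼,
      HasFDerivWithinAt (piolaTransform I f a (f x) ξ ∘ (extChartAt I a).symm) V' (Set.range I)
        (extChartAt I a x) ∧
      LinearMap.trace ℝ 𝔼 V' =
        (mfderivCoord I f a (f x) x).det * (density I (f x) (f x) *
          LinearMap.trace ℝ (TangentSpace I x)
            (e.symm.toContinuousLinearMap ∘L covDerivAlongL I f ξ x)) := by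
  have hfx := mem_chart_source H (f x)
  obtain ⟨D, hD, htrace⟩ := exists_hasMFDerivAt_density_smul_coords
    (hf.mdifferentiableAt two_ne_zero) hξ he
  let A := mfderivCoordEquiv I hx hfx e
  have hA : mfderivCoord I f a (f x) x = A := mfderivCoord_eq_equiv hx hfx he
  have hev := fderivWithin_eventuallyEq_mfderivCoord (hf.of_le one_le_two) hx hfx
  have hmem : extChartAt I a x ∈ Set.range I := ⟨chartAt H a x, rfl⟩
  have hsymm : (extChartAt I a).symm (extChartAt I a x) = x :=
    (extChartAt I a).left_inv (by simpa using hx)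
  obtain ⟨V', hV', hV'trace⟩ := hasFDerivWithinAt_det_smul_inverse I.uniqueDiffOn hmem
    (I.range_subset_closure_interior hmem) (contDiffWithinAt_writtenInCharts hf hx hfx) (A := A)
    ((hev.self_of_nhdsWithin hmem).trans ((congrArg _ hsymm).trans hA))
    (hasFDerivWithinAt_comp_extChartAt_symm hx hD)
  have htransform : piolaTransform I f a (f x) ξ ∘ (extChartAt I a).symm
      =ᶠ[𝓝[Set.range I] extChartAt I a x] _ :=
    hev.mono fun y hy ↦ congrArg (fun B : 𝔼 →L[ℝ] 𝔼 ↦ B.det • B.inverse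
      (density I (f x) (f ((extChartAt I a).symm y)) •
        coords I (f x) (f ((extChartAt I a).symm y)) (ξ ((extChartAt I a).symm y)))) hy.symm
  refine ⟨V', (htransform.hasFDerivWithinAt_iff (htransform.self_of_nhdsWithin hmem)).2 hV',
    hV'trace.trans ?_⟩
  rw [hA, ← htrace]
  congr 1
  exact LinearMap.trace_conj' (e.symm.toLinearMap ∘ₗ (coordFieldL I (f x) (f x)).toLinearMap ∘ₗ
      D.toLinearMap) (coordsEquiv I hx).toLinearEquiv

lemma contMDiffAt_piolaTransform (hf : ContMDiffAt I I 2 f x)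
    (hdf : (mfderiv I I f x).IsInvertible)
    (hξ : ContMDiffAt I I.tangent 1 (fun x ↦ (⟨f x, ξ x⟩ : TangentBundle I M₂)) x) :
    ContMDiffAt I 𝓘(ℝ, 𝔼) 1 (piolaTransform I f x (f x) ξ) x := by
  have hx := mem_chart_source H x
  have hfx := mem_chart_source H (f x)
  have hA : ContMDiffAt I 𝓘(ℝ, 𝔼 →L[ℝ] 𝔼) 1 (mfderivCoord I f x (f x)) x :=
    contMDiffAt_mfderivCoord hf (by norm_num) ENat.LEInfty.out
  obtain ⟨e, he⟩ := hdf
  have hAp : (mfderivCoord I f x (f x) x).IsInvertible :=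
    ⟨mfderivCoordEquiv I hx hfx e, (mfderivCoord_eq_equiv hx hfx he.symm).symm⟩
  have hinv := hAp.contDiffAt_map_inverse.contMDiffAt.comp x hA
  have hdet := (contDiff_det (E := 𝔼) (n := 1)).contMDiff.contMDiffAt.comp x hA
  have hρξ := ((contMDiffAt_density hfx).comp x (hf.of_le one_le_two)).smul
    ((contMDiffAt_along_iff (by simp) hfx).1 hξ).2
  exact hdet.smul (hinv.clm_apply hρξ)

end CoordinateDifferential
end Piola

section Divergence

variable {M : Type*} [TopologicalSpace M] [ChartedSpace H M] [IsManifold I ∞ M] {a x : M}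
  {M' : Type*} [TopologicalSpace M'] [ChartedSpace H M'] [IsManifold I ∞ M'] {f : M → M'} {b : M'}

lemma contMDiffAt_coords_comp_coordFieldL (ha : x ∈ (chartAt H a).source)
    {b : M} (hb : x ∈ (chartAt H b).source) :
    ContMDiffAt I 𝓘(ℝ, 𝔼 →L[ℝ] 𝔼) ∞ (fun y ↦ coords I b y ∘L coordFieldL I a y) x :=
  contMDiffAt_of_clm_apply fun u ↦
    ((contMDiffAt_along_iff (f := fun y ↦ y) le_rfl hb).1 (contMDiffAt_coordField ha u)).2

lemma mfderivCoord_id (a b x : M) :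
    mfderivCoord I (fun y : M ↦ y) a b x = coords I b x ∘L coordFieldL I a x :=
  congrArg (fun L : TangentSpace I x →L[ℝ] TangentSpace I x ↦
    coords I b x ∘L L ∘L coordFieldL I a x) (mfderiv_id (I := I))

lemma inverse_mfderivCoord_apply (hx : x ∈ (chartAt H a).source)
    (hfx : f x ∈ (chartAt H b).source) (hf : (mfderiv I I f x).IsInvertible)
    (v : TangentSpace I (f x)) :
    (mfderivCoord I f a b x).inverse (coords I b (f x) v) =
      coords I a x ((mfderiv I I f x).inverse v) := by
  obtain ⟨e, he⟩ := hf
  rw [mfderivCoord_eq_equiv hx hfx he.symm, ← he, ContinuousLinearMap.inverse_equiv,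
    ContinuousLinearMap.inverse_equiv]
  exact congrArg (fun v ↦ coords I a x (e.symm v)) (coordFieldL_coords hfx v)

lemma density_smul_coords_eq_piolaTransform [RiemannianBundle (fun x : M ↦ TangentSpace I x)]
    [RiemannianBundle (fun x : M' ↦ TangentSpace I x)]
    (hx : x ∈ (chartAt H a).source) (hfx : f x ∈ (chartAt H b).source)
    (hf : (mfderiv I I f x).IsInvertible) {c s : ℝ}
    (hc : c * density I a x = s * (mfderivCoord I f a b x).det * density I b (f x))
    (ξ : ∀ x, TangentSpace I (f x)) :
    density I a x • coords I a x (c • (mfderiv I I f x).inverse (ξ x)) =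
      s • piolaTransform I f a b ξ x := by
  rw [piolaTransform, map_smul, map_smul, inverse_mfderivCoord_apply hx hfx hf, smul_smul,
    smul_smul, smul_smul, mul_comm, hc]

variable [RiemannianBundle (fun x : M ↦ TangentSpace I x)]

lemma exists_eventually_density_eq {b : M} (ha : x ∈ (chartAt H a).source)
    (hb : x ∈ (chartAt H b).source) :
    ∃ s : ℝ, ∀ᶠ y in 𝓝 x, density I a y =
      s * (mfderivCoord I (fun y : M ↦ y) a b y).det * density I b y := by
  let J (y : M) : ℝ := (coords I b y ∘L coordFieldL I a y).det
  have hJ : ContinuousAt J x := ((contDiff_det (n := 1)).continuous.continuousAt).comp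
    (contMDiffAt_coords_comp_coordFieldL ha hb).continuousAt
  have hdensity : ∀ᶠ y in 𝓝 x, density I a y = |J y| * density I b y := by
    filter_upwards [(chartAt H b).open_source.mem_nhds hb] with y hy
    exact density_eq_abs_det_mul a hy
  have hJx : J x ≠ 0 := fun h ↦ (density_pos (I := I) ha).ne' <| by
    rw [hdensity.self_of_nhds, h, abs_zero, zero_mul]
  simp only [mfderivCoord_id]
  rcases lt_or_gt_of_ne hJx with hneg | hpos
  · refine ⟨-1, ?_⟩
    filter_upwards [hdensity, hJ.eventually_lt_const hneg] with y hy hJy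
    rw [hy, abs_of_neg hJy, neg_one_mul]
  · refine ⟨1, ?_⟩
    filter_upwards [hdensity, hJ.eventually_const_lt hpos] with y hy hJy
    rw [hy, abs_of_pos hJy, one_mul]

variable [IsContMDiffRiemannianBundle I 1 (EuclideanSpace ℝ (Fin d)) (fun x : M ↦ TangentSpace I x)]

variable (I) in
/-- The divergence `tr ∇W` of a vector field. -/
def divergence (W : ∀ x : M, TangentSpace I x) (x : M) : ℝ :=
  LinearMap.trace ℝ (TangentSpace I x) (covDerivAlongL I (fun y ↦ y) W x)

variable {W : ∀ x : M, TangentSpace I x}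

lemma exists_hasFDerivWithinAt_density_smul_coords (hx : x ∈ (chartAt H a).source)
    (hW : DifferentiableSectionAt I (fun y ↦ y) W x) :
    ∃ V' : 𝔼 →L[ℝ] 𝔼,
      HasFDerivWithinAt ((fun y ↦ density I a y • coords I a y (W y)) ∘ (extChartAt I a).symm) V'
        (Set.range I) (extChartAt I a x) ∧
      LinearMap.trace ℝ 𝔼 V' = density I a x * divergence I W x := by
  have hx' := mem_chart_source H x
  obtain ⟨s, hs⟩ := exists_eventually_density_eq (I := I) hx hx'
  obtain ⟨V', hV', htrace⟩ := exists_hasFDerivWithinAt_piolaTransform (ξ := W) hx contMDiffAt_id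
    (e := .refl ℝ (TangentSpace I x)) (mfderiv_id (I := I)) hW
  have htransform : ∀ᶠ y in 𝓝 x, density I a y • coords I a y (W y) =
      s • piolaTransform I (fun y ↦ y) a x W y := by
    filter_upwards [hs, (chartAt H a).open_source.mem_nhds hx,
      (chartAt H x).open_source.mem_nhds hx'] with y hy hya hyx
    have hid : mfderiv I I (fun y : M ↦ y) y = .id ℝ (TangentSpace I y) := mfderiv_id
    have h := density_smul_coords_eq_piolaTransform (f := fun y ↦ y) (c := 1) hya hyx
      ⟨.refl ℝ _, hid.symm⟩ ((one_mul _).trans hy) W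
    rwa [one_smul, hid, ContinuousLinearMap.inverse_id] at h
  have heq : (fun y ↦ density I a y • coords I a y (W y)) ∘ (extChartAt I a).symm
      =ᶠ[𝓝[Set.range I] extChartAt I a x]
        fun y ↦ s • piolaTransform I (fun y ↦ y) a x W ((extChartAt I a).symm y) :=
    tendsto_extChartAt_symm (I := I) hx htransform
  have hmem : extChartAt I a x ∈ Set.range I := ⟨chartAt H a x, rfl⟩
  refine ⟨s • V', (Filter.EventuallyEq.hasFDerivWithinAt_iff heq
    (heq.self_of_nhdsWithin hmem)).2 (hV'.const_smul s), ?_⟩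
  rw [ContinuousLinearMap.toLinearMap_smul, map_smul, htrace, smul_eq_mul, hs.self_of_nhds,
    mul_assoc, mul_assoc]
  rfl

end Divergence

/-! ### The cofactor and its coderivative -/

section DualField

variable {M₁ : Type*} [TopologicalSpace M₁] [ChartedSpace H M₁]
  {M₂ : Type*} [TopologicalSpace M₂] [ChartedSpace H M₂]
  [RiemannianBundle (fun x : M₁ ↦ TangentSpace I x)]
  [RiemannianBundle (fun x : M₂ ↦ TangentSpace I x)] {f : M₁ → M₂} {x : M₁}

/-- The vector field dual to the one-form `v ↦ ⟨α v, ξ⟩`, for a one-form `α` with values in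
`f^*TM₂` and a section `ξ` of `f^*TM₂`. -/
def dualField (α : ∀ x, TangentSpace I x →ₗ[ℝ] TangentSpace I (f x))
    (ξ : ∀ x, TangentSpace I (f x)) (x : M₁) : TangentSpace I x :=
  LinearMap.adjoint (α x) (ξ x)

lemma inner_dualField (α : ∀ x, TangentSpace I x →ₗ[ℝ] TangentSpace I (f x))
    (ξ : ∀ x, TangentSpace I (f x)) (v : TangentSpace I x) :
    inner ℝ v (dualField α ξ x) = inner ℝ (α x v) (ξ x) :=
  LinearMap.adjoint_inner_right _ _ _

end DualField

section CofactorField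

variable {M₁ : Type*} [TopologicalSpace M₁] [ChartedSpace H M₁] [IsManifold I ∞ M₁]
  {M₂ : Type*} [TopologicalSpace M₂] [ChartedSpace H M₂] [IsManifold I ∞ M₂]
  {f : M₁ → M₂} {a x p : M₁} {b : M₂}

lemma basis_det_mfderiv_coordFrame (hfx : f x ∈ (chartAt H b).source)
    {e : Basis (Fin d) ℝ (TangentSpace I (f x))} (he : ⇑e = coordFrame I b (f x)) :
    e.det (fun i ↦ mfderiv I I f x (coordFrame I a x i)) = (mfderivCoord I f a b x).det := by
  have h := basis_det_comp_single e (coordFieldL I b (f x)).toLinearMap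
    (mfderivCoord I f a b x).toLinearMap
  have hself : e.det (coordFrame I b (f x)) = 1 := he ▸ e.det_self
  have hframe : (fun i ↦ mfderiv I I f x (coordFrame I a x i)) = fun i ↦ coordFieldL I b (f x)
      (mfderivCoord I f a b x (EuclideanSpace.single i 1)) :=
    funext fun i ↦ (coordFieldL_coords hfx _).symm
  exact (congrArg _ hframe).trans (h.trans ((congrArg _ hself).trans (mul_one _)))

variable [RiemannianBundle (fun x : M₁ ↦ TangentSpace I x)]
  [RiemannianBundle (fun x : M₂ ↦ TangentSpace I x)]

lemma volumeForm_comp_mfderiv {o : Orientation ℝ (TangentSpace I x) (Fin d)}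
    {o' : Orientation ℝ (TangentSpace I (f x)) (Fin d)} (hx : x ∈ (chartAt H a).source)
    (hfx : f x ∈ (chartAt H b).source) {c s s' : ℝ} (hs : s * s = 1)
    (ho : o.volumeForm (coordFrame I a x) = s * density I a x)
    (ho' : o'.volumeForm (coordFrame I b (f x)) = s' * density I b (f x))
    (hc : c * density I a x = s * s' * (mfderivCoord I f a b x).det * density I b (f x)) :
    o'.volumeForm.compLinearMap (mfderiv I I f x : TangentSpace I x →ₗ[ℝ] TangentSpace I (f x)) =
      c • o.volumeForm := by
  obtain ⟨e, he⟩ := exists_coe_basis_eq_coordFrame (I := I) hx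
  obtain ⟨e', he'⟩ := exists_coe_basis_eq_coordFrame (I := I) hfx
  have hleft : o'.volumeForm (fun i ↦ mfderiv I I f x (coordFrame I a x i)) =
      s' * density I b (f x) * (mfderivCoord I f a b x).det := by
    rw [o'.volumeForm.eq_smul_basis_det e', AlternatingMap.smul_apply,
      basis_det_mfderiv_coordFrame hfx he', he', ho', smul_eq_mul]
  have heq : (o'.volumeForm.compLinearMap
      (mfderiv I I f x : TangentSpace I x →ₗ[ℝ] TangentSpace I (f x))) (coordFrame I a x) =
        (c • o.volumeForm) (coordFrame I a x) := by
    rw [AlternatingMap.smul_apply, ho, smul_eq_mul]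
    refine hleft.trans ?_
    linear_combination -s' * density I b (f x) * (mfderivCoord I f a b x).det * hs - s * hc
  rw [(o'.volumeForm.compLinearMap _).eq_smul_basis_det e, (c • o.volumeForm).eq_smul_basis_det e,
    he, heq]

variable [NeZero d] {o₁ : ManifoldOrientation I M₁} {o₂ : ManifoldOrientation I M₂}

lemma adjoint_cofDifferential_apply {c : ℝ}
    (h : (o₂.at' (f x)).volumeForm.compLinearMap
        (mfderiv I I f x : TangentSpace I x →ₗ[ℝ] TangentSpace I (f x)) =
      c • (o₁.at' x).volumeForm) (w : TangentSpace I x) :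
    LinearMap.adjoint (cofDifferential o₁ o₂ f x) (mfderiv I I f x w) = c • w := by
  refine ext_inner_left ℝ fun v ↦ ?_
  rw [LinearMap.adjoint_inner_right, inner_smul_right]
  exact inner_cof_apply h v w

lemma adjoint_cofDifferential_eq_smul_inverse {c : ℝ}
    (h : (o₂.at' (f x)).volumeForm.compLinearMap
        (mfderiv I I f x : TangentSpace I x →ₗ[ℝ] TangentSpace I (f x)) =
      c • (o₁.at' x).volumeForm) (hdf : (mfderiv I I f x).IsInvertible)
    (w : TangentSpace I (f x)) :
    LinearMap.adjoint (cofDifferential o₁ o₂ f x) w = c • (mfderiv I I f x).inverse w := by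
  rw [← adjoint_cofDifferential_apply h]
  obtain ⟨e, he⟩ := hdf
  rw [← he, ContinuousLinearMap.inverse_equiv]
  exact congrArg _ (e.apply_symm_apply w).symm

variable (o₁ o₂) in
lemma exists_eventually_volumeForm_comp_mfderiv (hf : ContinuousAt f p) :
    ∃ (s : ℝ) (c : M₁ → ℝ), ∀ᶠ x in 𝓝 p,
      c x * density I p x = s * (mfderivCoord I f p (f p) x).det * density I (f p) (f x) ∧
      (o₂.at' (f x)).volumeForm.compLinearMap
        (mfderiv I I f x : TangentSpace I x →ₗ[ℝ] TangentSpace I (f x)) =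
      c x • (o₁.at' x).volumeForm := by
  obtain ⟨s, hs, ho₁⟩ := exists_sign_volumeForm_coordFrame o₁ p
  obtain ⟨s', -, ho₂⟩ := exists_sign_volumeForm_coordFrame o₂ (f p)
  refine ⟨s * s', fun x ↦ s * s' * (mfderivCoord I f p (f p) x).det * density I (f p) (f x) /
    density I p x, ?_⟩
  filter_upwards [ho₁, hf.eventually ho₂, eventually_mem_chart_source (H := H) hf,
    (chartAt H p).open_source.mem_nhds (mem_chart_source H p)] with x ho₁ ho₂ hfx hx
  have hc := div_mul_cancel₀ (s * s' * (mfderivCoord I f p (f p) x).det * density I (f p) (f x))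
    (density_pos (I := I) hx).ne'
  exact ⟨hc, volumeForm_comp_mfderiv hx hfx hs ho₁ ho₂ hc⟩

lemma exists_eventually_density_smul_coords_dualField_cofDifferential (hf : ContinuousAt f p)
    (hdf : ∀ᶠ x in 𝓝 p, (mfderiv I I f x).IsInvertible) (ξ : ∀ x, TangentSpace I (f x)) :
    ∃ s c : ℝ, c * density I p p = s * (mfderivCoord I f p (f p) p).det * density I (f p) (f p) ∧
      (∀ w, LinearMap.adjoint (cofDifferential o₁ o₂ f p) w = c • (mfderiv I I f p).inverse w) ∧
      ∀ᶠ x in 𝓝 p, density I p x • coords I p x (dualField (cofDifferential o₁ o₂ f) ξ x) =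
        s • piolaTransform I f p (f p) ξ x := by
  obtain ⟨s, c, hc⟩ := exists_eventually_volumeForm_comp_mfderiv o₁ o₂ hf
  refine ⟨s, c p, hc.self_of_nhds.1,
    adjoint_cofDifferential_eq_smul_inverse hc.self_of_nhds.2 hdf.self_of_nhds, ?_⟩
  filter_upwards [hc, hdf, eventually_mem_chart_source (H := H) hf,
    (chartAt H p).open_source.mem_nhds (mem_chart_source H p)] with x ⟨hc, hvol⟩ hdf hfx hx
  rw [← density_smul_coords_eq_piolaTransform hx hfx hdf hc, dualField,
    adjoint_cofDifferential_eq_smul_inverse hvol hdf]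

section Divergence

variable
  [IsContMDiffRiemannianBundle I 1 (EuclideanSpace ℝ (Fin d)) (fun x : M₁ ↦ TangentSpace I x)]
  [IsContMDiffRiemannianBundle I 1 (EuclideanSpace ℝ (Fin d)) (fun x : M₂ ↦ TangentSpace I x)]
  {ξ : ∀ x, TangentSpace I (f x)}

lemma contMDiffAt_dualField_cofDifferential (hf : ContMDiffAt I I 2 f p)
    (hdf : ∀ᶠ x in 𝓝 p, (mfderiv I I f x).IsInvertible)
    (hξ : ContMDiffAt I I.tangent 1 (fun x ↦ (⟨f x, ξ x⟩ : TangentBundle I M₂)) p) :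
    ContMDiffAt I I.tangent 1
      (fun x ↦ (⟨x, dualField (cofDifferential o₁ o₂ f) ξ x⟩ : TangentBundle I M₁)) p := by
  have hp := mem_chart_source H p
  obtain ⟨s, -, -, -, hs⟩ := exists_eventually_density_smul_coords_dualField_cofDifferential
    (o₁ := o₁) (o₂ := o₂) hf.continuousAt hdf ξ
  refine (contMDiffAt_along_iff (f := fun x ↦ x) (by simp) hp).2 ⟨contMDiffAt_id, ?_⟩
  have hdiv := ((contMDiffAt_density (I := I) hp).inv₀ (density_pos hp).ne').smul
    ((contMDiffAt_const (I' := 𝓘(ℝ, ℝ)) (c := s)).smul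
      (contMDiffAt_piolaTransform hf hdf.self_of_nhds hξ))
  refine hdiv.congr_of_eventuallyEq ?_
  filter_upwards [hs, (chartAt H p).open_source.mem_nhds hp] with x hs hx
  exact ((inv_smul_smul₀ (density_pos (I := I) hx).ne' _).symm.trans
    (congrArg ((density I p x)⁻¹ • ·) hs))

theorem divergence_dualField_cofDifferential (hf : ContMDiffAt I I 2 f p)
    (hdf : ∀ᶠ x in 𝓝 p, (mfderiv I I f x).IsInvertible)
    (hξ : ContMDiffAt I I.tangent 1 (fun x ↦ (⟨f x, ξ x⟩ : TangentBundle I M₂)) p) :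
    divergence I (dualField (cofDifferential o₁ o₂ f) ξ) p =
      innerHom (cofDifferential o₁ o₂ f p) (covDerivAlong I f ξ p) := by
  have hp := mem_chart_source H p
  have hmem : extChartAt I p p ∈ Set.range I := ⟨chartAt H p p, rfl⟩
  obtain ⟨e, he⟩ := hdf.self_of_nhds
  obtain ⟨s, c, hc, hadj, hs⟩ := exists_eventually_density_smul_coords_dualField_cofDifferential
    (o₁ := o₁) (o₂ := o₂) hf.continuousAt hdf ξ
  obtain ⟨V, hV, hVtrace⟩ := exists_hasFDerivWithinAt_density_smul_coords hp
    (differentiableSectionAt_of_contMDiffAt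
      (contMDiffAt_dualField_cofDifferential (o₁ := o₁) (o₂ := o₂) hf hdf hξ))
  obtain ⟨V', hV', hV'trace⟩ := exists_hasFDerivWithinAt_piolaTransform hp hf he.symm
    (differentiableSectionAt_of_contMDiffAt hξ)
  have heq : (fun x ↦ density I p x • coords I p x
      (dualField (cofDifferential o₁ o₂ f) ξ x)) ∘ (extChartAt I p).symm
      =ᶠ[𝓝[Set.range I] extChartAt I p p]
        fun y ↦ s • piolaTransform I f p (f p) ξ ((extChartAt I p).symm y) :=
    tendsto_extChartAt_symm (I := I) hp hs
  have hVV' : V = s • V' := (I.uniqueDiffOn _ hmem).eq hV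
    ((heq.hasFDerivWithinAt_iff (heq.self_of_nhdsWithin hmem)).2 (hV'.const_smul s))
  have hinner : innerHom (cofDifferential o₁ o₂ f p) (covDerivAlong I f ξ p) =
      c * LinearMap.trace ℝ (TangentSpace I p)
        (e.symm.toContinuousLinearMap ∘L covDerivAlongL I f ξ p) := by
    refine (innerHom_eq_trace _ (covDerivAlongL I f ξ p).toLinearMap).trans ?_
    rw [← smul_eq_mul, ← map_smul]
    congr 1
    ext1 v
    refine (hadj _).trans ?_
    rw [← he, ContinuousLinearMap.inverse_equiv]
    rfl
  rw [hinner]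
  refine mul_left_cancel₀ (density_pos (I := I) hp).ne' ?_
  rw [← hVtrace, hVV', ContinuousLinearMap.toLinearMap_smul, map_smul, hV'trace, smul_eq_mul]
  linear_combination -(LinearMap.trace ℝ (TangentSpace I p)
    (e.symm.toContinuousLinearMap ∘L covDerivAlongL I f ξ p)) * hc

end Divergence

end CofactorField

section Coderivative

variable {M₁ : Type*} [TopologicalSpace M₁] [ChartedSpace H M₁]
  {M₂ : Type*} [TopologicalSpace M₂] [ChartedSpace H M₂] [IsManifold I ∞ M₂]
  {f : M₁ → M₂} {ξ : ∀ x, TangentSpace I (f x)} {p : M₁}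

lemma contMDiffAt_coordField_comp {n : WithTop ℕ∞} (hn : n ≤ ∞) (hf : ContMDiffAt I I n f p)
    (u : 𝔼) : ContMDiffAt I I.tangent n
      (fun x ↦ (⟨f x, coordField I (f p) u (f x)⟩ : TangentBundle I M₂)) p :=
  ((contMDiffAt_coordField (mem_chart_source H (f p)) u).of_le hn).comp p hf

variable [RiemannianBundle (fun x : M₂ ↦ TangentSpace I x)]
  [IsContMDiffRiemannianBundle I 1 (EuclideanSpace ℝ (Fin d)) (fun x : M₂ ↦ TangentSpace I x)]

lemma differentiableSectionAt_of_inner (hf : MDifferentiableAt I I f p)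
    (hξ : ∀ u, MDifferentiableAt I 𝓘(ℝ, ℝ)
      (fun x ↦ inner ℝ (coordField I (f p) u (f x)) (ξ x)) p) :
    DifferentiableSectionAt I f ξ p := by
  let e := stdOrthonormalBasis ℝ (TangentSpace I (f p))
  let G (x : M₁) : 𝔼 →L[ℝ] 𝔼 := raiseIndex (E := 𝔼) e (metricCoord I (f p) (f x))
  have hG : MDifferentiableAt I 𝓘(ℝ, 𝔼 →L[ℝ] 𝔼) G p :=
    (hasMFDerivAt_clm_comp (raiseIndex (E := 𝔼) e)
      ((hasMFDerivAt_metricCoord_self (f p)).comp p hf.hasMFDerivAt)).mdifferentiableAt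
  let s (x : M₁) : 𝔼 := ∑ i, inner ℝ (coordField I (f p) (e i) (f x)) (ξ x) • (e i : 𝔼)
  have hs : MDifferentiableAt I 𝓘(ℝ, 𝔼) s p := by
    have h := MDifferentiableAt.sum (t := Finset.univ) fun i _ ↦
      (hξ (e i)).smul (mdifferentiableAt_const (I := I) (c := (e i : 𝔼)))
    refine h.congr_of_eventuallyEq (.of_eq (funext fun x ↦ ?_))
    rw [Finset.sum_apply]
    rfl
  have hGp : G p = ContinuousLinearMap.id ℝ 𝔼 :=
    (congrArg (fun q ↦ raiseIndex (E := 𝔼) e (metricCoord I (f p) q)) rfl).trans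
      (raiseIndex_metricCoord_self e)
  have hinv : ContDiffAt ℝ 1 (ContinuousLinearMap.inverse : (𝔼 →L[ℝ] 𝔼) → 𝔼 →L[ℝ] 𝔼) (G p) :=
    ContinuousLinearMap.IsInvertible.contDiffAt_map_inverse ⟨.refl ℝ 𝔼, hGp.symm⟩
  have hGinv : MDifferentiableAt I 𝓘(ℝ, 𝔼 →L[ℝ] 𝔼) (fun x ↦ (G x).inverse) p :=
    (hinv.differentiableAt one_ne_zero).mdifferentiableAt.comp p hG
  have hGopen : ∀ᶠ x in 𝓝 p, (G x).IsInvertible :=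
    hG.continuousAt.eventually
      (ContinuousLinearEquiv.isOpen.mem_nhds ⟨.refl ℝ 𝔼, hGp.symm⟩)
  refine (hGinv.clm_apply hs).congr_of_eventuallyEq ?_
  filter_upwards [hGopen, eventually_mem_chart_source (H := H) hf.continuousAt] with x hGx hfx
  have hsx : s x = G x (coords I (f p) (f x) (ξ x)) := by
    refine Eq.trans (Finset.sum_congr rfl fun i _ ↦ ?_) (raiseIndex_apply (E := 𝔼) e _ _).symm
    rw [inner_eq_metricCoord hfx]
    exact congrArg (fun u ↦ metricCoord I (f p) (f x) u _ • (e i : 𝔼)) (coords_coordFieldL hfx _)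
  rw [hsx]
  exact (ContinuousLinearMap.IsInvertible.inverse_apply_self hGx _).symm

variable [IsManifold I ∞ M₁] [RiemannianBundle (fun x : M₁ ↦ TangentSpace I x)]
  [IsContMDiffRiemannianBundle I 1 (EuclideanSpace ℝ (Fin d)) (fun x : M₁ ↦ TangentSpace I x)]
  {α : ∀ x, TangentSpace I x →ₗ[ℝ] TangentSpace I (f x)}

lemma inner_covDerivForm (hf : MDifferentiableAt I I f p) (u v : TangentSpace I p)
    (hα : DifferentiableSectionAt I f (fun x ↦ α x (coordField I p u x)) p)
    (hξ : DifferentiableSectionAt I f ξ p)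
    (hW : DifferentiableSectionAt I (fun x ↦ x) (dualField α ξ) p) :
    inner ℝ (covDerivForm I f α p v u) (ξ p) =
      inner (E := TangentSpace I p) ℝ u (covDerivAlong I (fun x ↦ x) (dualField α ξ) p v) -
        inner ℝ (α p u) (covDerivAlong I f ξ p v) := by
  have hu : coordField I p u p = u := coordFieldL_self p u
  obtain ⟨D, hD, hDv⟩ := exists_hasMFDerivAt_inner hf hα hξ
  obtain ⟨D', hD', hD'v⟩ := exists_hasMFDerivAt_inner (f := fun x ↦ x) mdifferentiableAt_id
    (differentiableSectionAt_of_contMDiffAt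
      ((contMDiffAt_coordField (mem_chart_source H p) u).of_le ENat.LEInfty.out)) hW
  have hDD' : D = D' :=
    hasMFDerivAt_unique hD (hD'.congr_of_eventuallyEq
      (.of_eq (funext fun x ↦ (inner_dualField α ξ _).symm)))
  have h := (hDv v).symm.trans ((congrArg (· v) hDD').trans (hD'v v))
  rw [inner_dualField, hu] at h
  rw [covDerivForm, inner_sub_left]
  linear_combination h

theorem inner_coderivative (hf : MDifferentiableAt I I f p)
    (hα : ∀ u, DifferentiableSectionAt I f (fun x ↦ α x (coordField I p u x)) p)
    (hξ : DifferentiableSectionAt I f ξ p)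
    (hW : DifferentiableSectionAt I (fun x ↦ x) (dualField α ξ) p) :
    inner ℝ (coderivative I f α p) (ξ p) =
      innerHom (α p) (covDerivAlong I f ξ p) - divergence I (dualField α ξ) p := by
  rw [coderivative, inner_neg_left, sum_inner, divergence,
    LinearMap.trace_eq_sum_inner _ (stdOrthonormalBasis ℝ (TangentSpace I p)), innerHom,
    ← Finset.sum_sub_distrib, ← Finset.sum_neg_distrib]
  refine Finset.sum_congr rfl fun i _ ↦ ?_
  exact (congrArg Neg.neg (inner_covDerivForm hf _ _ (hα _) hξ hW)).trans (neg_sub _ _)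

lemma differentiableSectionAt_of_dualField (hf : ContMDiffAt I I 1 f p)
    (hW : ∀ ζ, DifferentiableSectionAt I (fun x ↦ x)
      (dualField α fun x ↦ coordField I (f p) ζ (f x)) p) (u : 𝔼) :
    DifferentiableSectionAt I f (fun x ↦ α x (coordField I p u x)) p := by
  refine differentiableSectionAt_of_inner (hf.mdifferentiableAt one_ne_zero) fun ζ ↦ ?_
  obtain ⟨D, hD, -⟩ := exists_hasMFDerivAt_inner (f := fun x ↦ x) mdifferentiableAt_id
    (differentiableSectionAt_of_contMDiffAt
      ((contMDiffAt_coordField (mem_chart_source H p) u).of_le ENat.LEInfty.out)) (hW ζ)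
  refine hD.mdifferentiableAt.congr_of_eventuallyEq (.of_eq (funext fun x ↦ ?_))
  exact (real_inner_comm _ _).trans (inner_dualField α (fun x ↦ coordField I (f p) ζ (f x)) _).symm

theorem coderivative_cofDifferential [NeZero d] {o₁ : ManifoldOrientation I M₁}
    {o₂ : ManifoldOrientation I M₂} (hf : ContMDiffAt I I 2 f p)
    (hdf : ∀ᶠ x in 𝓝 p, (mfderiv I I f x).IsInvertible) :
    coderivative I f (cofDifferential o₁ o₂ f) p = 0 := by
  have hζ (ζ : 𝔼) := contMDiffAt_coordField_comp ENat.LEInfty.out (hf.of_le one_le_two) ζ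
  have hW (ζ : 𝔼) := differentiableSectionAt_of_contMDiffAt
    (contMDiffAt_dualField_cofDifferential (o₁ := o₁) (o₂ := o₂) hf hdf (hζ ζ))
  refine ext_inner_right ℝ fun ζ ↦ ?_
  have h := inner_coderivative (hf.mdifferentiableAt two_ne_zero)
    (differentiableSectionAt_of_dualField (hf.of_le one_le_two) hW)
    (differentiableSectionAt_of_contMDiffAt (hζ ζ)) (hW ζ)
  rw [divergence_dualField_cofDifferential hf hdf (hζ ζ), sub_self] at h
  rw [inner_zero_left]
  refine Eq.trans ?_ h
  exact congrArg _ (coordFieldL_self (f p) ζ).symm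

end Coderivative

/-! ### The Riemannian volume and the divergence theorem -/

section Volume

lemma measurableSet_preimage_inter_of_continuousOn {X Y : Type*} [TopologicalSpace X]
    [MeasurableSpace X] [OpensMeasurableSpace X] [TopologicalSpace Y] [MeasurableSpace Y]
    [BorelSpace Y] {g : X → Y} {t : Set X} (hg : ContinuousOn g t) (ht : MeasurableSet t)
    {B : Set Y} (hB : MeasurableSet B) : MeasurableSet (t ∩ g ⁻¹' B) := by
  rw [← Subtype.image_preimage_coe]
  exact ht.subtype_image (hg.domRestrict.measurable hB)

variable {M : Type*} [TopologicalSpace M] [ChartedSpace H M]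

lemma measurableSet_extChartAt_target (q : M) : MeasurableSet (extChartAt I q).target := by
  rw [extChartAt_target]
  exact ((chartAt H q).open_target.preimage I.continuous_symm).measurableSet.inter
    I.isClosed_range.measurableSet

lemma aemeasurable_density_extChartAt_symm [IsManifold I ∞ M]
    [RiemannianBundle (fun x : M ↦ TangentSpace I x)]
    [IsContMDiffRiemannianBundle I 1 𝔼 (fun x : M ↦ TangentSpace I x)] (q : M) :
    AEMeasurable (fun y ↦ ENNReal.ofReal (density I q ((extChartAt I q).symm y)))
      ((volume : Measure 𝔼).restrict (extChartAt I q).target) := by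
  refine (ContinuousOn.aemeasurable (fun y hy ↦ ?_)
    (measurableSet_extChartAt_target q)).ennreal_ofReal
  have hq : (extChartAt I q).symm y ∈ (chartAt H q).source := by
    simpa using (extChartAt I q).map_target hy
  exact (contMDiffAt_density hq).continuousAt.comp_continuousWithinAt
    (continuousOn_extChartAt_symm q y hy)

lemma chartVolume_eq_map [MeasurableSpace M] [IsManifold I ∞ M]
    [RiemannianBundle (fun x : M ↦ TangentSpace I x)] (q : M) :
    chartVolume I q = Measure.map (extChartAt I q).symm
      ((volume.restrict (extChartAt I q).target).withDensity fun y ↦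
        ENNReal.ofReal (density I q ((extChartAt I q).symm y))) := rfl

variable [MeasurableSpace M] [BorelSpace M]

lemma aemeasurable_extChartAt_symm (q : M) :
    AEMeasurable (extChartAt I q).symm ((volume : Measure 𝔼).restrict (extChartAt I q).target) :=
  (continuousOn_extChartAt_symm q).aemeasurable (measurableSet_extChartAt_target q)

lemma measurableSet_image_extChartAt (q : M) {B : Set M} (hB : MeasurableSet B)
    (hq : B ⊆ (chartAt H q).source) : MeasurableSet (extChartAt I q '' B) := by
  rw [PartialEquiv.image_eq_target_inter_inv_preimage _ (by simpa using hq)]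
  exact measurableSet_preimage_inter_of_continuousOn (continuousOn_extChartAt_symm q)
    (measurableSet_extChartAt_target q) hB

variable [IsManifold I ∞ M] [RiemannianBundle (fun x : M ↦ TangentSpace I x)]

lemma chartVolume_apply (q : M) {B : Set M} (hB : MeasurableSet B) :
    chartVolume I q B = ∫⁻ y in extChartAt I q '' (B ∩ (chartAt H q).source),
      ENNReal.ofReal (density I q ((extChartAt I q).symm y)) := by
  rw [chartVolume_eq_map, Measure.map_apply_of_aemeasurable
    ((aemeasurable_extChartAt_symm q).mono_ac (withDensity_absolutelyContinuous _ _)) hB,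
    withDensity_apply', Measure.restrict_restrict' (measurableSet_extChartAt_target q),
    ← extChartAt_source I, Set.inter_comm B, PartialEquiv.image_source_inter_eq', Set.inter_comm]

lemma chartVolume_eq_zero {q : M} {B : Set M} (hB : MeasurableSet B)
    (h : Disjoint B (chartAt H q).source) : chartVolume I q B = 0 := by
  rw [chartVolume_apply q hB, h.inter_eq, Set.image_empty, Measure.restrict_empty,
    lintegral_zero_measure]

lemma chartVolume_eq_of_subset {q r : M} {B : Set M} (hB : MeasurableSet B)
    (hq : B ⊆ (chartAt H q).source) (hr : B ⊆ (chartAt H r).source) :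
    chartVolume I q B = chartVolume I r B := by
  rw [chartVolume_apply q hB, chartVolume_apply r hB, Set.inter_eq_left.2 hq,
    Set.inter_eq_left.2 hr]
  have hsymm {x : M} (hx : x ∈ B) : (extChartAt I q).symm (extChartAt I q x) = x :=
    (extChartAt I q).left_inv (by simpa using hq hx)
  let ψ : 𝔼 → 𝔼 := extChartAt I r ∘ (extChartAt I q).symm
  have hψ : extChartAt I r '' B = ψ '' (extChartAt I q '' B) := by
    rw [Set.image_image]
    exact Set.image_congr fun x hx ↦ congrArg (extChartAt I r) (hsymm hx).symm
  have hinj : Set.InjOn ψ (extChartAt I q '' B) := by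
    rintro _ ⟨x, hx, rfl⟩ _ ⟨x', hx', rfl⟩ h
    simp only [ψ, Function.comp_apply, hsymm hx, hsymm hx'] at h
    rw [(extChartAt I r).injOn (by simpa using hr hx) (by simpa using hr hx') h]
  have hderiv : ∀ y ∈ extChartAt I q '' B, HasFDerivWithinAt ψ
      (coords I r ((extChartAt I q).symm y) ∘L coordFieldL I q ((extChartAt I q).symm y))
      (extChartAt I q '' B) y := by
    rintro _ ⟨x, hx, rfl⟩
    rw [hsymm hx]
    refine (hasFDerivWithinAt_comp_extChartAt_symm (hq hx)
      (hasMFDerivAt_extChartAt_coords (hr hx))).mono ?_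
    rintro _ ⟨x, -, rfl⟩
    exact ⟨chartAt H q x, rfl⟩
  rw [hψ, lintegral_image_eq_lintegral_abs_det_fderiv_mul _
    (measurableSet_image_extChartAt q hB hq) hderiv hinj]
  refine setLIntegral_congr_fun (measurableSet_image_extChartAt q hB hq) ?_
  intro y hy
  have hy' : (extChartAt I q).symm y ∈ B := by
    obtain ⟨x, hx, rfl⟩ := hy
    rwa [hsymm hx]
  have hr' : (extChartAt I r).symm (ψ y) = (extChartAt I q).symm y :=
    (extChartAt I r).left_inv (by simpa using hr hy')
  beta_reduce
  rw [hr', density_eq_abs_det_mul q (hr hy'), ENNReal.ofReal_mul (abs_nonneg _)]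

lemma chartVolume_le (q r : M) : chartVolume I r ≤
    chartVolume I q + ((⊤ : ENNReal) • Measure.count).restrict (chartAt H q).sourceᶜ := by
  have hq : MeasurableSet (chartAt H q).source := (chartAt H q).open_source.measurableSet
  have hr : MeasurableSet (chartAt H r).source := (chartAt H r).open_source.measurableSet
  refine Measure.le_iff.2 fun B hB ↦ ?_
  rw [← measure_inter_add_sdiff B hq, Measure.add_apply]
  refine add_le_add ?_ ?_
  · rw [← measure_inter_add_sdiff (B ∩ _) hr,
      chartVolume_eq_zero (q := r) ((hB.inter hq).diff hr) Set.disjoint_sdiff_left, add_zero,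
      ← chartVolume_eq_of_subset (q := q) ((hB.inter hq).inter hr)
        (fun x hx ↦ hx.1.2) (fun x hx ↦ hx.2)]
    exact measure_mono fun x hx ↦ hx.1.1
  · rw [Measure.restrict_apply hB, ← Set.sdiff_eq]
    rcases (B \ (chartAt H q).source).eq_empty_or_nonempty with h | h
    · simp [h]
    · rw [Measure.smul_apply, smul_eq_mul, ENNReal.top_mul (Measure.count_ne_zero h)]
      exact le_top

theorem riemannianVolume_restrict (q : M) :
    (riemannianVolume I M).restrict (chartAt H q).source = chartVolume I q := by
  have hq : MeasurableSet (chartAt H q).source := (chartAt H q).open_source.measurableSet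
  refine Measure.ext fun B hB ↦ ?_
  have hinter : chartVolume I q B = chartVolume I q (B ∩ (chartAt H q).source) := by
    rw [← measure_inter_add_sdiff B hq,
      chartVolume_eq_zero (q := q) (hB.diff hq) Set.disjoint_sdiff_left, add_zero]
  rw [Measure.restrict_apply hB, hinter]
  refine le_antisymm ?_ (Measure.le_iff.1 (le_iSup (chartVolume I) q) _ (hB.inter hq))
  refine (Measure.le_iff.1 (iSup_le (chartVolume_le (I := I) q)) _ (hB.inter hq)).trans ?_
  rw [Measure.add_apply, Measure.restrict_apply (hB.inter hq), Set.inter_assoc,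
    Set.inter_compl_self, Set.inter_empty, measure_empty, add_zero]

variable [IsContMDiffRiemannianBundle I 1 (EuclideanSpace ℝ (Fin d)) (fun x : M ↦ TangentSpace I x)]
  {G : Type*} [NormedAddCommGroup G] [NormedSpace ℝ G] {u : M → G}

lemma integrableOn_chartAt_source_iff (q : M)
    (hu : AEStronglyMeasurable u ((riemannianVolume I M).restrict (chartAt H q).source)) :
    IntegrableOn u (chartAt H q).source (riemannianVolume I M) ↔
      IntegrableOn (fun y ↦ density I q ((extChartAt I q).symm y) • u ((extChartAt I q).symm y))
        (extChartAt I q).target := by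
  rw [riemannianVolume_restrict, chartVolume_eq_map] at hu
  rw [IntegrableOn, riemannianVolume_restrict, chartVolume_eq_map, integrable_map_measure hu
    ((aemeasurable_extChartAt_symm q).mono_ac (withDensity_absolutelyContinuous _ _)),
    integrable_withDensity_iff_integrable_smul₀' (aemeasurable_density_extChartAt_symm q)
      (.of_forall fun _ ↦ ENNReal.ofReal_lt_top), IntegrableOn]
  exact iff_of_eq (congrArg (Integrable · _) (funext fun y ↦ congrArg (· • _)
    (ENNReal.toReal_ofReal (Real.sqrt_nonneg _))))

lemma setIntegral_chartAt_source (q : M)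
    (hu : AEStronglyMeasurable u ((riemannianVolume I M).restrict (chartAt H q).source)) :
    ∫ x in (chartAt H q).source, u x ∂(riemannianVolume I M) =
      ∫ y in (extChartAt I q).target,
        density I q ((extChartAt I q).symm y) • u ((extChartAt I q).symm y) := by
  rw [riemannianVolume_restrict, chartVolume_eq_map] at hu ⊢
  rw [integral_map ((aemeasurable_extChartAt_symm q).mono_ac
      (withDensity_absolutelyContinuous _ _)) hu,
    integral_withDensity_eq_integral_toReal_smul₀ (aemeasurable_density_extChartAt_symm q)
      (.of_forall fun _ ↦ ENNReal.ofReal_lt_top)]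
  exact congrArg (integral _) (funext fun y ↦ congrArg (· • _)
    (ENNReal.toReal_ofReal (Real.sqrt_nonneg _)))

end Volume

section EuclideanDivergence

variable {E : Type*} [NormedAddCommGroup E] [NormedSpace ℝ E]
  [MeasurableSpace E] [BorelSpace E] {μ : Measure E} {V : E → E}

lemma integrable_fderiv_of_hasCompactSupport [IsFiniteMeasureOnCompacts μ]
    (hV : ContDiff ℝ 1 V) (hc : HasCompactSupport V) :
    Integrable (fderiv ℝ V) μ :=
  (hV.continuous_fderiv one_ne_zero).integrable_of_hasCompactSupport (hc.fderiv (𝕜 := ℝ))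

variable [FiniteDimensional ℝ E] [μ.IsAddHaarMeasure]

lemma integral_fderiv_of_hasCompactSupport (hV : ContDiff ℝ 1 V) (hc : HasCompactSupport V) :
    ∫ y, fderiv ℝ V y ∂μ = 0 := by
  ext v
  have hintegrable := integrable_fderiv_of_hasCompactSupport (μ := μ) hV hc
  have h := integral_smul_fderiv_eq_neg_fderiv_smul_of_integrable (𝕜 := ℝ) (μ := μ)
    (f := fun _ ↦ (1 : ℝ)) (g := V) (v := v) (by simp)
    (by simpa using hintegrable.apply_continuousLinearMap v)
    (by simpa using hV.continuous.integrable_of_hasCompactSupport hc)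
    (fun _ _ ↦ differentiableAt_const _) (fun y _ ↦ hV.differentiable one_ne_zero y)
  simpa [ContinuousLinearMap.integral_apply hintegrable] using h

lemma integrable_trace_fderiv (hV : ContDiff ℝ 1 V) (hc : HasCompactSupport V) :
    Integrable (fun y ↦ LinearMap.trace ℝ E (fderiv ℝ V y)) μ :=
  (traceCLM E).integrable_comp (integrable_fderiv_of_hasCompactSupport hV hc)

lemma integral_trace_fderiv (hV : ContDiff ℝ 1 V) (hc : HasCompactSupport V) :
    ∫ y, LinearMap.trace ℝ E (fderiv ℝ V y) ∂μ = 0 := by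
  refine ((traceCLM E).integral_comp_comm (integrable_fderiv_of_hasCompactSupport hV hc)).trans ?_
  rw [integral_fderiv_of_hasCompactSupport hV hc, map_zero]

end EuclideanDivergence

section DivergenceTheorem

variable {M : Type*} [TopologicalSpace M] [ChartedSpace H M] [IsManifold I ∞ M] {a x : M}

lemma extChartAt_mem_interior_target (ha : x ∈ (chartAt H a).source) (hx : x ∈ I.interior M) :
    extChartAt I a x ∈ interior (extChartAt I a).target :=
  (I.isInteriorPoint_iff_of_mem_atlas (n := ∞) (by simp) (chart_mem_atlas H a) ha).1 hx

variable [RiemannianBundle (fun x : M ↦ TangentSpace I x)]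
  [IsContMDiffRiemannianBundle I 1 (EuclideanSpace ℝ (Fin d)) (fun x : M ↦ TangentSpace I x)]
  {W : ∀ x : M, TangentSpace I x}

lemma trace_fderivWithin_density_smul_coords (hx : x ∈ (chartAt H a).source)
    (hW : DifferentiableSectionAt I (fun y ↦ y) W x) :
    LinearMap.trace ℝ 𝔼 (fderivWithin ℝ ((fun y ↦ density I a y • coords I a y (W y)) ∘
      (extChartAt I a).symm) (Set.range I) (extChartAt I a x)) =
        density I a x * divergence I W x := by
  obtain ⟨V', hV', htrace⟩ := exists_hasFDerivWithinAt_density_smul_coords hx hW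
  rw [hV'.fderivWithin (I.uniqueDiffOn _ ⟨chartAt H a x, rfl⟩), htrace]

lemma contDiffWithinAt_density_smul_coords (hx : x ∈ (chartAt H a).source)
    (hW : ContMDiffAt I I.tangent 1 (fun y ↦ (⟨y, W y⟩ : TangentBundle I M)) x) :
    ContDiffWithinAt ℝ 1 ((fun y ↦ density I a y • coords I a y (W y)) ∘ (extChartAt I a).symm)
      (Set.range I) (extChartAt I a x) := by
  have h : ContMDiffAt I 𝓘(ℝ, 𝔼) 1 (fun y ↦ density I a y • coords I a y (W y)) x :=
    (contMDiffAt_density hx).smul ((contMDiffAt_along_iff (by simp) hx).1 hW).2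
  have : IsManifold I 1 M := .of_le (n := ∞) (by simp)
  exact ((contMDiffAt_iff_of_mem_source hx (mem_chart_source _ _)).1 h).2

lemma divergence_eq_zero (hW : ∀ᶠ y in 𝓝 x, W y = 0) : divergence I W x = 0 := by
  have hx := mem_chart_source H x
  have hW' : DifferentiableSectionAt I (fun y ↦ y) W x :=
    (mdifferentiableAt_const (c := (0 : 𝔼))).congr_of_eventuallyEq
      (hW.mono fun y hy ↦ (congrArg (coords I x y) hy).trans (map_zero _))
  have heq : (fun y ↦ density I x y • coords I x y (W y)) ∘ (extChartAt I x).symm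
      =ᶠ[𝓝[Set.range I] extChartAt I x x] fun _ ↦ 0 :=
    Filter.Eventually.mono (tendsto_extChartAt_symm (I := I) hx hW) fun y hy ↦
      (congrArg (fun v ↦ density I x _ • coords I x _ v) hy).trans (by rw [map_zero, smul_zero])
  have h := trace_fderivWithin_density_smul_coords hx hW'
  rw [heq.fderivWithin_eq_of_mem ⟨chartAt H x x, rfl⟩, fderivWithin_fun_const] at h
  exact (mul_eq_zero.1 ((h.symm.trans (map_zero _)))).resolve_left (density_pos hx).ne'

lemma divergence_sum {ι : Type*} (s : Finset ι) {W : ι → ∀ x : M, TangentSpace I x}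
    (hW : ∀ i ∈ s, DifferentiableSectionAt I (fun y ↦ y) (W i) x) :
    divergence I (fun z ↦ ∑ i ∈ s, W i z) x = ∑ i ∈ s, divergence I (W i) x := by
  have hx := mem_chart_source H x
  have hW' : DifferentiableSectionAt I (fun y ↦ y) (fun z ↦ ∑ i ∈ s, W i z) x := by
    have h : MDifferentiableAt I 𝓘(ℝ, 𝔼) (∑ i ∈ s, fun y ↦ coords I x y (W i y)) x :=
      Finset.sum_induction _ (MDifferentiableAt I 𝓘(ℝ, 𝔼) · x) (fun _ _ ↦ .add)
        mdifferentiableAt_const hW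
    refine h.congr_of_eventuallyEq (.of_forall fun y ↦ ?_)
    simp only [map_sum, Finset.sum_apply]
  have hsum : (fun y ↦ density I x y • coords I x y (∑ i ∈ s, W i y)) ∘ (extChartAt I x).symm =
      fun y ↦ ∑ i ∈ s, ((fun y ↦ density I x y • coords I x y (W i y)) ∘
        (extChartAt I x).symm) y := by
    ext1 y
    simp only [Function.comp_apply, map_sum, Finset.smul_sum]
  have h := trace_fderivWithin_density_smul_coords hx hW'
  have hterm {i : ι} (hi : i ∈ s) := trace_fderivWithin_density_smul_coords hx (hW i hi)
  have hdiff : ∀ i ∈ s, DifferentiableWithinAt ℝ ((fun y ↦ density I x y • coords I x y (W i y)) ∘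
      (extChartAt I x).symm) (Set.range I) (extChartAt I x x) := fun i hi ↦
    let ⟨_, hV', _⟩ := exists_hasFDerivWithinAt_density_smul_coords hx (hW i hi)
    hV'.differentiableWithinAt
  rw [hsum, fderivWithin_fun_sum (I.uniqueDiffOn (extChartAt I x x) ⟨chartAt H x x, rfl⟩) hdiff,
    ← traceCLM_apply, map_sum] at h
  refine mul_left_cancel₀ (density_pos (I := I) hx).ne' (h.symm.trans ?_)
  rw [Finset.mul_sum]
  exact Finset.sum_congr rfl fun i hi ↦ hterm hi

lemma continuousAt_divergence
    (hW : ContMDiffAt I I.tangent 1 (fun y ↦ (⟨y, W y⟩ : TangentBundle I M)) x) :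
    ContinuousAt (divergence I W) x := by
  have hx := mem_chart_source H x
  have : IsManifold I 1 M := .of_le (n := ∞) (by simp)
  have hsource : ∀ᶠ y in 𝓝 x, y ∈ (chartAt H x).source := (chartAt H x).open_source.mem_nhds hx
  have hdiv : divergence I W =ᶠ[𝓝 x] fun y ↦ (density I x y)⁻¹ * traceCLM 𝔼 (fderivWithin ℝ
      ((fun y ↦ density I x y • coords I x y (W y)) ∘ (extChartAt I x).symm) (Set.range I)
      (extChartAt I x y)) := by
    filter_upwards [(contMDiffAt_iff_contMDiffAt_nhds (by simp)).1 hW, hsource] with y hWy hy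
    rw [traceCLM_apply, trace_fderivWithin_density_smul_coords hy
      (differentiableSectionAt_of_contMDiffAt hWy), inv_mul_cancel_left₀ (density_pos hy).ne']
  have hchart : Filter.Tendsto (extChartAt I x) (𝓝 x) (𝓝[Set.range I] extChartAt I x x) :=
    tendsto_nhdsWithin_iff.2 ⟨continuousAt_extChartAt x, .of_forall fun y ↦ ⟨chartAt H x y, rfl⟩⟩
  have hfderiv := ((contDiffWithinAt_density_smul_coords hx hW).fderivWithin_right (m := 0)
    I.uniqueDiffOn (by simp) ⟨chartAt H x x, rfl⟩).continuousWithinAt.tendsto.comp hchart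
  refine ContinuousAt.congr (.mul ?_ ?_) hdiv.symm
  · exact (contMDiffAt_density hx).continuousAt.inv₀ (density_pos hx).ne'
  · exact ((traceCLM 𝔼).continuous.tendsto _).comp hfderiv

lemma exists_contDiff_trace_fderiv_eq
    (hW : ContMDiff I I.tangent 1 (fun y ↦ (⟨y, W y⟩ : TangentBundle I M))) {K : Set M}
    (hK : IsCompact K) (hKI : K ⊆ I.interior M) (hKa : K ⊆ (chartAt H a).source)
    (hW0 : ∀ x ∉ K, W x = 0) :
    ∃ V : 𝔼 → 𝔼, ContDiff ℝ 1 V ∧ HasCompactSupport V ∧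
      tsupport V ⊆ (extChartAt I a).target ∧
      ∀ x ∈ (chartAt H a).source, LinearMap.trace ℝ 𝔼 (fderiv ℝ V (extChartAt I a x)) =
        density I a x * divergence I W x := by
  let g : 𝔼 → 𝔼 := (fun y ↦ density I a y • coords I a y (W y)) ∘ (extChartAt I a).symm
  let V : 𝔼 → 𝔼 := (extChartAt I a).target.indicator g
  have hKa' : K ⊆ (extChartAt I a).source := by simpa using hKa
  have hC : IsCompact (extChartAt I a '' K) :=
    hK.image_of_continuousOn ((continuousOn_extChartAt a).mono hKa')
  have hV0 : ∀ y ∉ extChartAt I a '' K, V y = 0 := by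
    refine fun y hy ↦ Set.indicator_apply_eq_zero.2 fun hyt ↦ ?_
    have hyK : (extChartAt I a).symm y ∉ K := fun h ↦ hy ⟨_, h, (extChartAt I a).right_inv hyt⟩
    simp only [g, Function.comp_apply, hW0 _ hyK, map_zero, smul_zero]
  have hsupport : tsupport V ⊆ extChartAt I a '' K :=
    closure_minimal (fun y hy ↦ not_not.1 fun hyK ↦ hy (hV0 y hyK)) hC.isClosed
  have hVg {x : M} (hx : x ∈ (chartAt H a).source) :
      V =ᶠ[𝓝[Set.range I] extChartAt I a x] g :=
    Filter.mem_of_superset (extChartAt_target_mem_nhdsWithin' (by simpa using hx))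
      fun y hy ↦ Set.indicator_of_mem hy g
  have hV : ContDiff ℝ 1 V := by
    refine contMDiff_iff_contDiff.1 (contMDiff_of_tsupport fun y hy ↦ ContDiffAt.contMDiffAt ?_)
    obtain ⟨x, hx, rfl⟩ := hsupport hy
    have hrange : Set.range I ∈ 𝓝 (extChartAt I a x) :=
      Filter.mem_of_superset
        (mem_interior_iff_mem_nhds.1 (extChartAt_mem_interior_target (hKa hx) (hKI hx)))
        (extChartAt_target_subset_range a)
    exact ((contDiffWithinAt_density_smul_coords (hKa hx) (hW x)).congr_of_eventuallyEq
      (hVg (hKa hx)) ((hVg (hKa hx)).self_of_nhdsWithin ⟨chartAt H a x, rfl⟩)).contDiffAt hrange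
  refine ⟨V, hV, hC.of_isClosed_subset (isClosed_tsupport V) hsupport, ?_, fun x hx ↦ ?_⟩
  · exact hsupport.trans (Set.image_subset_iff.2 fun x hx ↦ (extChartAt I a).map_source (hKa' hx))
  · have hmem : extChartAt I a x ∈ Set.range I := ⟨chartAt H a x, rfl⟩
    rw [← (hV.differentiable one_ne_zero _).fderivWithin (I.uniqueDiffOn _ hmem),
      (hVg hx).fderivWithin_eq_of_mem hmem]
    exact trace_fderivWithin_density_smul_coords hx (differentiableSectionAt_of_contMDiffAt (hW x))

variable [T2Space M] [MeasurableSpace M] [BorelSpace M]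

lemma integrable_and_integral_divergence_eq_zero_of_subset_source
    (hW : ContMDiff I I.tangent 1 (fun y ↦ (⟨y, W y⟩ : TangentBundle I M))) {K : Set M}
    (hK : IsCompact K) (hKI : K ⊆ I.interior M) (hKa : K ⊆ (chartAt H a).source)
    (hW0 : ∀ x ∉ K, W x = 0) :
    Integrable (divergence I W) (riemannianVolume I M) ∧
      ∫ x, divergence I W x ∂(riemannianVolume I M) = 0 := by
  obtain ⟨V, hV, hc, hVt, htrace⟩ := exists_contDiff_trace_fderiv_eq hW hK hKI hKa hW0
  have hdiv0 : ∀ x ∉ (chartAt H a).source, divergence I W x = 0 := fun x hx ↦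
    divergence_eq_zero (Filter.mem_of_superset
      (hK.isClosed.isOpen_compl.mem_nhds fun h ↦ hx (hKa h)) hW0)
  have hmeas : AEStronglyMeasurable (divergence I W)
      ((riemannianVolume I M).restrict (chartAt H a).source) :=
    (continuous_iff_continuousAt.2 fun x ↦ continuousAt_divergence (hW x)).aestronglyMeasurable
  have htrace' : Set.EqOn (fun y ↦ density I a ((extChartAt I a).symm y) •
      divergence I W ((extChartAt I a).symm y)) (fun y ↦ LinearMap.trace ℝ 𝔼 (fderiv ℝ V y))
      (extChartAt I a).target := fun y hy ↦ by
    have h := htrace ((extChartAt I a).symm y) (by simpa using (extChartAt I a).map_target hy)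
    rw [(extChartAt I a).right_inv hy] at h
    exact h.symm
  have ht := measurableSet_extChartAt_target (I := I) a
  have hV0 : ∀ y ∉ (extChartAt I a).target, LinearMap.trace ℝ 𝔼 (fderiv ℝ V y) = 0 := fun y hy ↦ by
    rw [image_eq_zero_of_notMem_tsupport fun h ↦ hy (hVt (tsupport_fderiv_subset ℝ h))]
    exact map_zero _
  constructor
  · rw [← integrableOn_iff_integrable_of_support_subset
      (Function.support_subset_iff'.2 hdiv0), integrableOn_chartAt_source_iff a hmeas,
      integrableOn_congr_fun htrace' ht]
    exact (integrable_trace_fderiv hV hc).integrableOn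
  · rw [← setIntegral_eq_integral_of_forall_compl_eq_zero hdiv0, setIntegral_chartAt_source a hmeas,
      setIntegral_congr_fun ht htrace', setIntegral_eq_integral_of_forall_compl_eq_zero hV0,
      integral_trace_fderiv hV hc]

theorem integrable_and_integral_divergence_eq_zero [SigmaCompactSpace M]
    (hW : ContMDiff I I.tangent 1 (fun y ↦ (⟨y, W y⟩ : TangentBundle I M))) {K : Set M}
    (hK : IsCompact K) (hKI : K ⊆ I.interior M) (hW0 : ∀ x ∉ K, W x = 0) :
    Integrable (divergence I W) (riemannianVolume I M) ∧
      ∫ x, divergence I W x ∂(riemannianVolume I M) = 0 := by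
  obtain ⟨ρ, hρ⟩ :=
    SmoothPartitionOfUnity.exists_isSubordinate_chartAt_source_of_isClosed I hK.isClosed
  let s := (ρ.locallyFinite.finite_nonempty_inter_compact hK).toFinset
  have hsum : W = fun x ↦ ∑ i ∈ s, ρ i x • W x := by
    ext1 x
    by_cases hx : x ∈ K
    · have hs : (Function.support fun i ↦ ρ i x) ⊆ s := fun i hi ↦ by
        simpa [s] using ⟨x, hi, hx⟩
      rw [← Finset.sum_smul, ← finsum_eq_sum_of_support_subset _ hs, ρ.sum_eq_one hx, one_smul]
    · simp [hW0 x hx]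
  have hρW (i : K) : ContMDiff I I.tangent 1 (fun x ↦ (⟨x, ρ i x • W x⟩ : TangentBundle I M)) :=
    ((ρ i).contMDiff.of_le (by simp)).smul_section hW
  have hlocal (i : K) := integrable_and_integral_divergence_eq_zero_of_subset_source (hρW i)
    (hK.inter_right (isClosed_tsupport (ρ i))) (fun x hx ↦ hKI hx.1) (fun x hx ↦ hρ i hx.2)
    fun x hx ↦ by
      by_cases hxK : x ∈ K
      · rw [image_eq_zero_of_notMem_tsupport fun h ↦ hx ⟨hxK, h⟩, zero_smul]
      · rw [hW0 x hxK, smul_zero]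
  have hdiv : divergence I W = fun x ↦ ∑ i ∈ s, divergence I (fun x ↦ ρ i x • W x) x := by
    ext1 x
    conv_lhs => rw [hsum]
    exact divergence_sum s fun i _ ↦ differentiableSectionAt_of_contMDiffAt (hρW i x)
  rw [hdiv, integral_finsetSum _ fun i _ ↦ (hlocal i).1]
  exact ⟨integrable_finsetSum _ fun i _ ↦ (hlocal i).1, Finset.sum_eq_zero fun i _ ↦ (hlocal i).2⟩

end DivergenceTheorem

/-! ### Test sections and the weak form -/

section VolumeMeasure

variable {M : Type*} [TopologicalSpace M] [ChartedSpace H M] [IsManifold I ∞ M]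

lemma dense_interior : Dense (I.interior M) := by
  refine dense_iff_inter_open.2 fun U hU ⟨x, hx⟩ ↦ ?_
  obtain ⟨O, hO, hxO, hOU⟩ := mem_nhdsWithin.1 <| Filter.inter_mem
    (extChartAt_target_mem_nhdsWithin (I := I) x)
    (mem_nhdsWithin_of_mem_nhds <| (continuousAt_extChartAt_symm (I := I) x).preimage_mem_nhds
      (by rw [extChartAt_to_inv]; exact hU.mem_nhds hx))
  obtain ⟨y, hyO, hyI⟩ := mem_closure_iff_nhds.1
    (I.range_subset_closure_interior ⟨chartAt H x x, rfl⟩) O (hO.mem_nhds hxO)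
  obtain ⟨hyT, hyU⟩ := hOU ⟨hyO, interior_subset hyI⟩
  have hysource : (extChartAt I x).symm y ∈ (chartAt H x).source := by
    simpa using (extChartAt I x).map_target hyT
  refine ⟨_, hyU, (I.isInteriorPoint_iff_of_mem_atlas (n := ∞) (by simp)
    (chart_mem_atlas H x) hysource).2 ?_⟩
  change extChartAt I x ((extChartAt I x).symm y) ∈ interior (extChartAt I x).target
  rw [(extChartAt I x).right_inv hyT]
  exact interior_maximal (fun z hz ↦ (hOU ⟨hz.1, interior_subset hz.2⟩).1)
    (hO.inter isOpen_interior) ⟨hyO, hyI⟩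

variable [RiemannianBundle (fun x : M ↦ TangentSpace I x)] [MeasurableSpace M] [BorelSpace M]

lemma riemannianVolume_apply_of_subset (q : M) {B : Set M} (hB : MeasurableSet B)
    (hq : B ⊆ (chartAt H q).source) : riemannianVolume I M B =
      ∫⁻ y in extChartAt I q '' B, ENNReal.ofReal (density I q ((extChartAt I q).symm y)) := by
  rw [← Measure.restrict_eq_self _ hq, riemannianVolume_restrict, chartVolume_apply q hB,
    Set.inter_eq_left.2 hq]

variable
  [IsContMDiffRiemannianBundle I 1 (EuclideanSpace ℝ (Fin d)) (fun x : M ↦ TangentSpace I x)]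

instance isLocallyFiniteMeasure_riemannianVolume :
    IsLocallyFiniteMeasure (riemannianVolume I M) where
  finiteAtNhds x := by
    have hnhds : {z | z ∈ (chartAt H x).source ∧
        extChartAt I x z ∈ Metric.ball (extChartAt I x x) 1 ∧
        density I x z < density I x x + 1} ∈ 𝓝 x := by
      filter_upwards [(chartAt H x).open_source.mem_nhds (mem_chart_source H x),
        (continuousAt_extChartAt (I := I) x).preimage_mem_nhds (Metric.ball_mem_nhds _ one_pos),
        (contMDiffAt_density (I := I) (mem_chart_source H x)).continuousAt.eventually_lt_const
          (lt_add_one _)] with z hz hz' hz''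
      exact ⟨hz, hz', hz''⟩
    obtain ⟨U, hUsub, hU, hxU⟩ := mem_nhds_iff.1 hnhds
    refine ⟨U, hU.mem_nhds hxU, ?_⟩
    rw [riemannianVolume_apply_of_subset x hU.measurableSet fun z hz ↦ (hUsub hz).1]
    have hball : extChartAt I x '' U ⊆ Metric.ball (extChartAt I x x) 1 :=
      Set.image_subset_iff.2 fun z hz ↦ (hUsub hz).2.1
    refine setLIntegral_lt_top_of_le_nnreal ((measure_mono hball).trans_lt measure_ball_lt_top).ne
      ⟨(density I x x + 1).toNNReal, ?_⟩
    rintro _ ⟨z, hz, rfl⟩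
    rw [(extChartAt I x).left_inv (by simpa using (hUsub hz).1)]
    exact ENNReal.ofReal_le_ofReal (hUsub hz).2.2.le

instance isOpenPosMeasure_riemannianVolume : (riemannianVolume I M).IsOpenPosMeasure where
  open_pos U hU hne hzero := by
    obtain ⟨x, hxI, hxU⟩ := dense_interior (I := I).exists_mem_open hU hne
    let V := U ∩ (chartAt H x).source
    have hV : IsOpen V := hU.inter (chartAt H x).open_source
    have himage : extChartAt I x '' V ∈ 𝓝 (extChartAt I x x) :=
      extChartAt_image_nhds_mem_nhds_of_mem_interior_range (mem_extChartAt_source x)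
        (interior_mono (extChartAt_target_subset_range x)
          (extChartAt_mem_interior_target (mem_chart_source H x) hxI))
        (hV.mem_nhds ⟨hxU, mem_chart_source H x⟩)
    have hVzero := measure_mono_null (Set.inter_subset_left : V ⊆ U) hzero
    rw [riemannianVolume_apply_of_subset x hV.measurableSet Set.inter_subset_right,
      lintegral_eq_zero_iff' ((aemeasurable_density_extChartAt_symm x).mono_set
        (Set.image_subset_iff.2 fun z hz ↦ (extChartAt I x).map_source (by simpa using hz.2))),
      Filter.EventuallyEq,
      ae_restrict_iff' (measurableSet_image_extChartAt x hV.measurableSet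
        Set.inter_subset_right)] at hVzero
    refine (Measure.measure_pos_of_mem_nhds volume himage).ne' (measure_eq_zero_iff_ae_notMem.2 ?_)
    filter_upwards [hVzero] with y hy hyV
    obtain ⟨z, hz, rfl⟩ := id hyV
    have h := hy hyV
    rw [(extChartAt I x).left_inv (by simpa using hz.2)] at h
    exact (ENNReal.ofReal_pos.2 (density_pos hz.2)).ne' h

end VolumeMeasure

section TestSections

variable {M₁ : Type*} [TopologicalSpace M₁] [ChartedSpace H M₁] [IsManifold I ∞ M₁]
  {M₂ : Type*} [TopologicalSpace M₂] [ChartedSpace H M₂] [IsManifold I ∞ M₂]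
  {f : M₁ → M₂} {η : ∀ x, TangentSpace I (f x)}

lemma isTestSection_bump_smul_coordField [T2Space M₁] (hf : ContMDiff I I 1 f) {q : M₁} {a : M₂}
    (b : SmoothBumpFunction I q) (hb : ∀ x ∈ tsupport b, f x ∈ (chartAt H a).source)
    (hbI : tsupport b ⊆ I.interior M₁) (u : 𝔼) :
    IsTestSection I f (fun x ↦ b x • coordField I a u (f x)) := by
  have hzero {x : M₁} (hx : x ∉ tsupport b) : b x • coordField I a u (f x) = 0 := by
    rw [image_eq_zero_of_notMem_tsupport hx, zero_smul]
  refine ⟨fun p ↦ ?_, tsupport b, b.hasCompactSupport, hbI, fun x ↦ hzero⟩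
  by_cases hp : p ∈ tsupport b
  · have hsection := (contMDiffAt_along_iff (by simp) (hb p hp)).1
      (((contMDiffAt_coordField (I := I) (hb p hp) u).of_le (by simp)).comp p (hf p))
    refine (contMDiffAt_along_iff (by simp) (hb p hp)).2 ⟨hf p, ?_⟩
    refine ((b.contMDiffAt.of_le (by simp)).smul hsection.2).congr_of_eventuallyEq
      (.of_forall fun x ↦ ?_)
    exact map_smul _ _ _
  · refine (contMDiffAt_along_iff (by simp) (mem_chart_source H (f p))).2 ⟨hf p, ?_⟩
    refine (contMDiffAt_const (c := 0)).congr_of_eventuallyEq ?_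
    filter_upwards [(isClosed_tsupport b).isOpen_compl.mem_nhds hp] with x hx
    rw [hzero hx, map_zero]

lemma eq_zero_of_eqOn_interior (hη : Continuous (fun x ↦ (⟨f x, η x⟩ : TangentBundle I M₂)))
    (h0 : ∀ x ∈ I.interior M₁, η x = 0) (x : M₁) : η x = 0 := by
  have hcont : ContinuousAt (fun z ↦ (trivializationAt 𝔼 (TangentSpace I)
      (f x) (⟨f z, η z⟩ : TangentBundle I M₂)).2) x :=
    ((FiberBundle.continuousAt_totalSpace _ _).1 hη.continuousAt).2
  have hf : Continuous f := (FiberBundle.continuous_proj 𝔼 (TangentSpace I)).comp hη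
  have hcoords : ContinuousAt (fun z ↦ coords I (f x) (f z) (η z)) x := by
    refine hcont.congr ?_
    filter_upwards [hf.continuousAt.preimage_mem_nhds
      ((chartAt H (f x)).open_source.mem_nhds (mem_chart_source H (f x)))] with z hz
    exact (coords_apply hz _).symm
  have hclosure : coords I (f x) (f x) (η x) ∈ closure {0} :=
    hcoords.continuousWithinAt.mem_closure (dense_interior (I := I) x) fun z hz ↦
      (congrArg (coords I (f x) (f z)) (h0 z hz)).trans (map_zero _)
  rw [closure_singleton, Set.mem_singleton_iff, coords_self] at hclosure
  exact hclosure

variable [RiemannianBundle (fun x : M₁ ↦ TangentSpace I x)]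
  [IsContMDiffRiemannianBundle I 1 (EuclideanSpace ℝ (Fin d)) (fun x : M₁ ↦ TangentSpace I x)]
  [RiemannianBundle (fun x : M₂ ↦ TangentSpace I x)]
  [IsContMDiffRiemannianBundle I 1 (EuclideanSpace ℝ (Fin d)) (fun x : M₂ ↦ TangentSpace I x)]
  [T2Space M₁] [MeasurableSpace M₁] [BorelSpace M₁]

lemma eq_zero_of_mem_interior (hf : ContMDiff I I 1 f)
    (hη : Continuous (fun x ↦ (⟨f x, η x⟩ : TangentBundle I M₂)))
    (h : ∀ σ : ∀ x, TangentSpace I (f x), IsTestSection I f σ →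
      ∫ x, inner ℝ (σ x) (η x) ∂(riemannianVolume I M₁) = 0)
    {q : M₁} (hq : q ∈ I.interior M₁) : η q = 0 := by
  by_contra hne
  have : IsContinuousRiemannianBundle 𝔼 (fun x : M₂ ↦ TangentSpace I x) := by
    obtain ⟨g, hg, hg'⟩ := IsContMDiffRiemannianBundle.exists_contMDiff (IB := I) (n := 1)
      (F := 𝔼) (E := fun x : M₂ ↦ TangentSpace I x)
    exact ⟨⟨g, hg.continuous, hg'⟩⟩
  let τ (x : M₁) : TangentSpace I (f x) := coordField I (f q) (η q) (f x)
  have hτq : τ q = η q := coordFieldL_self (f q) (η q)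
  have hpos : 0 < inner ℝ (τ q) (η q) := by
    rw [hτq]
    exact real_inner_self_pos.2 hne
  have hcont : ContinuousAt (fun x ↦ inner ℝ (τ x) (η x)) q :=
    ContinuousAt.inner_bundle (F := 𝔼) (E := fun x : M₂ ↦ TangentSpace I x)
      (contMDiffAt_coordField_comp (by simp) (hf q) (η q)).continuousAt hη.continuousAt
  have hU : {x | 0 < inner ℝ (τ x) (η x) ∧ f x ∈ (chartAt H (f q)).source ∧
      x ∈ I.interior M₁} ∈ 𝓝 q := by
    filter_upwards [hcont.eventually_const_lt hpos,
      hf.continuous.continuousAt.preimage_mem_nhds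
        ((chartAt H (f q)).open_source.mem_nhds (mem_chart_source H (f q))),
      (I.isOpen_interior (M := M₁) (n := ∞) (by simp)).mem_nhds hq] with x h1 h2 h3
    exact ⟨h1, h2, h3⟩
  obtain ⟨b, -, hb⟩ := (SmoothBumpFunction.nhds_basis_tsupport (I := I) q).mem_iff.1 hU
  have hσ := isTestSection_bump_smul_coordField hf b (fun x hx ↦ (hb hx).2.1)
    (fun x hx ↦ (hb hx).2.2) (η q)
  have hb0 {x : M₁} (hx : x ∉ tsupport b) : inner ℝ (b x • τ x) (η x) = 0 := by
    rw [image_eq_zero_of_notMem_tsupport hx, zero_smul, inner_zero_left]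
  refine (Continuous.integral_pos_of_hasCompactSupport_nonneg_nonzero (x := q)
    (Continuous.inner_bundle (F := 𝔼) (E := fun x : M₂ ↦ TangentSpace I x)
      hσ.contMDiff.continuous hη) (HasCompactSupport.intro b.hasCompactSupport fun x ↦ hb0)
    (fun x ↦ ?_) ?_).ne' (h _ hσ)
  · by_cases hx : x ∈ tsupport b
    · rw [real_inner_smul_left]
      exact mul_nonneg b.nonneg (hb hx).1.le
    · exact (hb0 hx).ge
  · simpa only [b.eq_one, one_smul] using hpos.ne'

theorem eq_zero_of_forall_integral_inner (hf : ContMDiff I I 1 f)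
    (hη : Continuous (fun x ↦ (⟨f x, η x⟩ : TangentBundle I M₂)))
    (h : ∀ σ : ∀ x, TangentSpace I (f x), IsTestSection I f σ →
      ∫ x, inner ℝ (σ x) (η x) ∂(riemannianVolume I M₁) = 0) (x : M₁) : η x = 0 :=
  eq_zero_of_eqOn_interior hη (fun _ ↦ eq_zero_of_mem_interior hf hη h) x

end TestSections

section PiolaIdentity

variable {M₁ : Type*} [TopologicalSpace M₁] [ChartedSpace H M₁] [IsManifold I ∞ M₁]
  [RiemannianBundle (fun x : M₁ ↦ TangentSpace I x)]
  [IsContMDiffRiemannianBundle I 1 (EuclideanSpace ℝ (Fin d)) (fun x : M₁ ↦ TangentSpace I x)]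
  [T2Space M₁] [SigmaCompactSpace M₁] [MeasurableSpace M₁] [BorelSpace M₁]
  {M₂ : Type*} [TopologicalSpace M₂] [ChartedSpace H M₂] [IsManifold I ∞ M₂]
  [RiemannianBundle (fun x : M₂ ↦ TangentSpace I x)]
  [IsContMDiffRiemannianBundle I 1 (EuclideanSpace ℝ (Fin d)) (fun x : M₂ ↦ TangentSpace I x)]
  {f : M₁ → M₂}

theorem integrable_and_integral_innerHom_cofDifferential_eq_zero [NeZero d]
    (o₁ : ManifoldOrientation I M₁) (o₂ : ManifoldOrientation I M₂)
    (hf : ContMDiff I I 2 f) (hdf : ∀ x, (mfderiv I I f x).IsInvertible)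
    {ξ : ∀ x, TangentSpace I (f x)} (hξ : IsTestSection I f ξ) :
    Integrable (fun x ↦ innerHom (cofDifferential o₁ o₂ f x) (covDerivAlong I f ξ x))
        (riemannianVolume I M₁) ∧
      ∫ x, innerHom (cofDifferential o₁ o₂ f x) (covDerivAlong I f ξ x)
        ∂(riemannianVolume I M₁) = 0 := by
  obtain ⟨K, hK, hKI, hξ0⟩ := hξ.compactSupport
  have hdiv : (fun x ↦ innerHom (cofDifferential o₁ o₂ f x) (covDerivAlong I f ξ x)) =
      divergence I (dualField (cofDifferential o₁ o₂ f) ξ) := funext fun p ↦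
    (divergence_dualField_cofDifferential (hf p) (.of_forall hdf) (hξ.contMDiff p)).symm
  rw [hdiv]
  refine integrable_and_integral_divergence_eq_zero
    (fun p ↦ contMDiffAt_dualField_cofDifferential (hf p) (.of_forall hdf) (hξ.contMDiff p))
    hK hKI fun x hx ↦ ?_
  rw [dualField, hξ0 x hx, map_zero]

theorem isAdjointCoderivative_cofDifferential_iff [NeZero d]
    (o₁ : ManifoldOrientation I M₁) (o₂ : ManifoldOrientation I M₂)
    (hf : ContMDiff I I 2 f) (hdf : ∀ x, (mfderiv I I f x).IsInvertible)
    {η : ∀ x, TangentSpace I (f x)}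
    (hη : Continuous (fun x ↦ (⟨f x, η x⟩ : TangentBundle I M₂))) :
    IsAdjointCoderivative I f (cofDifferential o₁ o₂ f) η ↔ ∀ x, η x = 0 := by
  have hweak {σ : ∀ x, TangentSpace I (f x)} (hσ : IsTestSection I f σ) :
      ∫ x, innerHom (covDerivAlong I f σ x) (cofDifferential o₁ o₂ f x)
        ∂(riemannianVolume I M₁) = 0 := by
    simp_rw [innerHom_comm (covDerivAlong I f σ _)]
    exact (integrable_and_integral_innerHom_cofDifferential_eq_zero o₁ o₂ hf hdf hσ).2
  refine ⟨fun h ↦ eq_zero_of_forall_integral_inner (hf.of_le one_le_two) hη fun σ hσ ↦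
    (h σ hσ).trans (hweak hσ), fun h σ hσ ↦ ?_⟩
  simp_rw [h, inner_zero_right, integral_zero, hweak hσ]

end PiolaIdentity

theorem mainTheorem1_general [NeZero d]
    {M₁ : Type*} [TopologicalSpace M₁] [T2Space M₁] [SigmaCompactSpace M₁]
    [MeasurableSpace M₁] [BorelSpace M₁] [ChartedSpace H M₁] [IsManifold I ∞ M₁]
    [RiemannianBundle (fun x : M₁ ↦ TangentSpace I x)]
    [IsContMDiffRiemannianBundle I 1 (EuclideanSpace ℝ (Fin d)) (fun x : M₁ ↦ TangentSpace I x)]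
    (o₁ : ManifoldOrientation I M₁)
    {M₂ : Type*} [TopologicalSpace M₂] [ChartedSpace H M₂] [IsManifold I ∞ M₂]
    [RiemannianBundle (fun x : M₂ ↦ TangentSpace I x)]
    [IsContMDiffRiemannianBundle I 1 (EuclideanSpace ℝ (Fin d)) (fun x : M₂ ↦ TangentSpace I x)]
    (o₂ : ManifoldOrientation I M₂)
    {f : M₁ → M₂} (hf : ContMDiff I I 2 f) (hdf : ∀ x, (mfderiv I I f x).IsInvertible) :
    (∀ p : M₁, coderivative I f (cofDifferential o₁ o₂ f) p = 0) ∧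
    (∀ η : ∀ x, TangentSpace I (f x), Continuous (fun x ↦ (⟨f x, η x⟩ : TangentBundle I M₂)) →
      (IsAdjointCoderivative I f (cofDifferential o₁ o₂ f) η ↔ ∀ x, η x = 0)) ∧
    (∀ ξ : ∀ x, TangentSpace I (f x), IsTestSection I f ξ →
      Integrable (fun x ↦ innerHom (cofDifferential o₁ o₂ f x) (covDerivAlong I f ξ x))
        (riemannianVolume I M₁) ∧
      ∫ x, innerHom (cofDifferential o₁ o₂ f x) (covDerivAlong I f ξ x)
        ∂(riemannianVolume I M₁) = 0) :=
  ⟨fun p ↦ coderivative_cofDifferential (hf p) (.of_forall hdf),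
    fun _ hη ↦ isAdjointCoderivative_cofDifferential_iff o₁ o₂ hf hdf hη,
    fun _ hξ ↦ integrable_and_integral_innerHom_cofDifferential_eq_zero o₁ o₂ hf hdf hξ⟩

end RiemannianPiola

end

open RiemannianPiola in
theorem mainTheorem1 (d : ℕ) [NeZero d]
    {M₁ : Type*} [TopologicalSpace M₁] [T2Space M₁] [SecondCountableTopology M₁]
    [MeasurableSpace M₁] [BorelSpace M₁]
    [ChartedSpace (EuclideanHalfSpace d) M₁] [IsManifold (𝓡∂ d) ∞ M₁]
    [RiemannianBundle (fun x : M₁ ↦ TangentSpace (𝓡∂ d) x)]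
    [IsContMDiffRiemannianBundle (𝓡∂ d) ∞ (EuclideanSpace ℝ (Fin d))
      (fun x : M₁ ↦ TangentSpace (𝓡∂ d) x)]
    (o₁ : ManifoldOrientation (𝓡∂ d) M₁)
    {M₂ : Type*} [TopologicalSpace M₂] [T2Space M₂] [SecondCountableTopology M₂]
    [ChartedSpace (EuclideanHalfSpace d) M₂] [IsManifold (𝓡∂ d) ∞ M₂]
    [RiemannianBundle (fun x : M₂ ↦ TangentSpace (𝓡∂ d) x)]
    [IsContMDiffRiemannianBundle (𝓡∂ d) ∞ (EuclideanSpace ℝ (Fin d))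
      (fun x : M₂ ↦ TangentSpace (𝓡∂ d) x)]
    (o₂ : ManifoldOrientation (𝓡∂ d) M₂)
    (f : M₁ → M₂) (hf : IsLocalDiffeomorph (𝓡∂ d) (𝓡∂ d) 2 f) :
    (∀ p : M₁, coderivative (𝓡∂ d) f (cofDifferential o₁ o₂ f) p = 0) ∧
    (∀ η : ∀ x, TangentSpace (𝓡∂ d) (f x),
      Continuous (fun x ↦ (⟨f x, η x⟩ : TangentBundle (𝓡∂ d) M₂)) →
      (IsAdjointCoderivative (𝓡∂ d) f (cofDifferential o₁ o₂ f) η ↔ ∀ x, η x = 0)) ∧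
    (∀ ξ : ∀ x, TangentSpace (𝓡∂ d) (f x), IsTestSection (𝓡∂ d) f ξ →
      Integrable (fun x ↦ innerHom (cofDifferential o₁ o₂ f x) (covDerivAlong (𝓡∂ d) f ξ x))
        (riemannianVolume (𝓡∂ d) M₁) ∧
      ∫ x, innerHom (cofDifferential o₁ o₂ f x) (covDerivAlong (𝓡∂ d) f ξ x)
        ∂(riemannianVolume (𝓡∂ d) M₁) = 0) :=
  have : LocallyCompactSpace M₁ := Manifold.locallyCompact_of_finiteDimensional (𝓡∂ d)
  have : IsContMDiffRiemannianBundle (𝓡∂ d) 1 (EuclideanSpace ℝ (Fin d))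
    (fun x : M₁ ↦ TangentSpace (𝓡∂ d) x) := .of_le (n := ∞) (by simp)
  have : IsContMDiffRiemannianBundle (𝓡∂ d) 1 (EuclideanSpace ℝ (Fin d))
    (fun x : M₂ ↦ TangentSpace (𝓡∂ d) x) := .of_le (n := ∞) (by simp)
  mainTheorem1_general o₁ o₂ hf.contMDiff fun x ↦
    ⟨hf.mfderivToContinuousLinearEquiv two_ne_zero x, rfl⟩
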